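/- Notation. Let $\phi=\frac{1+\sqrt5}{2}$ and let $(F_n)_{n\ge0}$ be the Fibonacci numbers, $F_0=0$, $F_1=1$, $F_n=F_{n-1}+F_{n-2}$. The Wythoff array $(W_{i,k})_{i,k\ge1}$ is given by $W_{i,1}=\lfloor\phi\lfloor\phi i\rfloor\rfloor$, $W_{i,2}=\lfloor\phi^2\lfloor\phi i\rfloor\rfloor$ and $W_{i,k}=W_{i,k-1}+W_{i,k-2}$ for $k\ge3$. For $i\ge1$ put $$w_+(i)=\phi^{-2}W_{i,1}+\phi^{-1}W_{i,2},\qquad w_-(i)=\phi^{2}W_{i,1}-\phi W_{i,2},\qquad \eta_i=-w_+(i)w_-(i),$$ $$w_+^*(i)=-w_-(i),\qquad \mu_i=\min\{m\ge1: W_{i,1}<\tfrac12F_{m+2}\},\qquad W^*_{i,m}=F_{m+1}W_{i,2}-F_{m+2}W_{i,1}\quad(m\ge0);$$ equivalently, $W^*_{i,n-k}=(-1)^k(F_{n-1}W_{i,k}-F_nW_{i,k-1})$ for all $2\le k\le n$. For $\sigma>1$ and $f:\mathbb R\to\mathbb R$ put $$\delta_{f,\sigma}(i)=\sum_{k=1}^\infty\left(\frac{f(0)}{\pi^\sigma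 W_{i,k}^\sigma}\,\frac{f(w_+^*(i)\phi^{-k})}{\sin(\pi w_+^*(i)\phi^{-k})^\sigma}-\frac{f(0)^2\,5^{\sigma/2}}{\pi^{2\sigma}\eta_i^\sigma}\right),$$ $$\delta^*_{f,\sigma}(i)=\sum_{j=1}^\infty\left(\frac{f(w_+(i)\phi^{-(\mu_i+j)})}{\sin(\pi w_+(i)\phi^{-(\mu_i+j)})^\sigma}\,\frac{f(0)}{\pi^\sigma (W^*_{i,\mu_i+j})^\sigma}-\frac{f(0)^2\,5^{\sigma/2}}{\pi^{2\sigma}\eta_i^\sigma}\right),$$ $$C=\frac{2f(0)^2\,5^{\sigma/2}}{\pi^{2\sigma}}\sum_{i=1}^\infty\frac1{\eta_i^\sigma},\qquad D=2\sum_{i=1}^\infty\left(\delta_{f,\sigma}(i)+\delta^*_{f,\sigma}(i)-\frac{f(0)^2\,5^{\sigma/2}}{\pi^{2\sigma}}\,\frac{\mu_i+1}{\eta_i^\sigma}\right).$$ Theorem. Let $\sigma>1$, $0<\alpha\le1$, and let $f:\mathbb R\to\mathbb R$ be $1$-periodic, symmetric ($f(t)=f(1-t)$) and $\alpha$-Hölder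 continuous in the sense that there is $L\ge0$ with $|f(x)-f(y)|\le L|x-y|^\alpha$ for all $x,y\in[0,1)$. Then the series defining $\delta_{f,\sigma}(i)$ and $\delta^*_{f,\sigma}(i)$ (for every $i\ge1$), $C$ and $D$ all converge absolutely, and as $n\to\infty$ $$\frac1{F_n^\sigma}\sum_{m=1}^{F_n-1}\frac{f(m/F_n)}{|\sin(\pi m/F_n)|^\sigma}\,\frac{f(F_{n-1}m/F_n)}{|\sin(\pi F_{n-1}m/F_n)|^\sigma}=Cn+D+O\!\left(\frac{n^2}{\phi^{\min\{\alpha,\sigma-1\}\,n/2}}\right),$$ where the implied constant may depend on $\sigma$, $f$ and $\alpha$. In particular $C$ and $D$ depend only on $\sigma$ and $f$. -/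

import Mathlib

namespace FibLattice

noncomputable section

/-- The Wythoff array `W_{i,k}` for `i, k ≥ 1`: `W_{i,1} = ⌊φ⌊φ i⌋⌋`, `W_{i,2} = ⌊φ² ⌊φ i⌋⌋` and
`W_{i,k} = W_{i,k-1} + W_{i,k-2}` for `k ≥ 3`. The column `k = 0` continues the recurrence
backwards. -/
def wythoff (i : ℕ) : ℕ → ℤ
  | 0 => ⌊Real.goldenRatio ^ 2 * (⌊Real.goldenRatio * (i : ℝ)⌋ : ℝ)⌋
      - ⌊Real.goldenRatio * (⌊Real.goldenRatio * (i : ℝ)⌋ : ℝ)⌋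
  | 1 => ⌊Real.goldenRatio * (⌊Real.goldenRatio * (i : ℝ)⌋ : ℝ)⌋
  | 2 => ⌊Real.goldenRatio ^ 2 * (⌊Real.goldenRatio * (i : ℝ)⌋ : ℝ)⌋
  | k + 3 => wythoff i (k + 2) + wythoff i (k + 1)

/-- `w₊(i) = φ⁻² W_{i,1} + φ⁻¹ W_{i,2}`. -/
def wPlus (i : ℕ) : ℝ :=
  (wythoff i 1 : ℝ) / Real.goldenRatio ^ 2 + (wythoff i 2 : ℝ) / Real.goldenRatio

/-- `w₋(i) = φ² W_{i,1} - φ W_{i,2}`. -/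
def wMinus (i : ℕ) : ℝ :=
  Real.goldenRatio ^ 2 * (wythoff i 1 : ℝ) - Real.goldenRatio * (wythoff i 2 : ℝ)

/-- `η_i = - w₊(i) w₋(i)`. -/
def eta (i : ℕ) : ℝ := -(wPlus i * wMinus i)

/-- `μ_i = min {m ≥ 1 : W_{i,1} < F_{m+2} / 2}`. -/
def mu (i : ℕ) : ℕ :=
  sInf {m : ℕ | 1 ≤ m ∧ (wythoff i 1 : ℝ) < (Nat.fib (m + 2) : ℝ) / 2}

/-- The dual array `W*_{i,m}`. It is given by `W*_{i,n-k} = (-1)^k (F_{n-1} W_{i,k} - F_n W_{i,k-1})`,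
which depends on `n - k` only (see `wythoffDual_eq`); the value below is the one for `k = 2`,
`n = m + 2`. -/
def wythoffDual (i m : ℕ) : ℤ :=
  (Nat.fib (m + 1) : ℤ) * wythoff i 2 - (Nat.fib (m + 2) : ℤ) * wythoff i 1

theorem wythoff_add_two (i k : ℕ) :
    wythoff i (k + 2) = wythoff i (k + 1) + wythoff i k := by
  cases k with
  | zero => simp [wythoff]
  | succ k => rfl

/-- The formula `W*_{i,n-k} = (-1)^k (F_{n-1} W_{i,k} - F_n W_{i,k-1})`, with `k + 1` for `k` and
`n = m + k + 1`. -/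
theorem wythoffDual_eq (i m k : ℕ) :
    wythoffDual i m = (-1) ^ (k + 1) *
      ((Nat.fib (m + k) : ℤ) * wythoff i (k + 1) - (Nat.fib (m + k + 1) : ℤ) * wythoff i k) := by
  induction k with
  | zero =>
    have h := wythoff_add_two i 0
    have hf : Nat.fib (m + 2) = Nat.fib m + Nat.fib (m + 1) := Nat.fib_add_two
    simp only [Nat.zero_add] at h
    simp only [wythoffDual, h, hf]
    push_cast
    ring_nf
  | succ k ih =>
    have h := wythoff_add_two i k
    have hf : Nat.fib (m + k + 2) = Nat.fib (m + k) + Nat.fib (m + k + 1) := Nat.fib_add_two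
    have e1 : m + (k + 1) = m + k + 1 := by ring
    have e2 : k + 1 + 1 = k + 2 := by ring
    have e3 : m + k + 1 + 1 = m + k + 2 := by ring
    rw [ih, e1, e2, e3, h, hf]
    push_cast
    ring

/-- The limiting value `f(0)² 5^{σ/2} / (π^{2σ} η_i^σ)` of the terms belonging to row `i`. -/
def rowLimit (σ : ℝ) (f : ℝ → ℝ) (i : ℕ) : ℝ :=
  f 0 ^ 2 * (5 : ℝ) ^ (σ / 2) / (Real.pi ^ (2 * σ) * eta i ^ σ)

/-- The `k`-th term of the series `δ_{f,σ}(i)`; here `w₊*(i) = - w₋(i)`. -/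
def deltaTerm (σ : ℝ) (f : ℝ → ℝ) (i k : ℕ) : ℝ :=
  f 0 / (Real.pi ^ σ * (wythoff i k : ℝ) ^ σ)
      * (f (-wMinus i / Real.goldenRatio ^ k)
          / Real.sin (Real.pi * (-wMinus i / Real.goldenRatio ^ k)) ^ σ)
    - rowLimit σ f i

/-- The `j`-th term of the series `δ*_{f,σ}(i)`. -/
def deltaDualTerm (σ : ℝ) (f : ℝ → ℝ) (i j : ℕ) : ℝ :=
  f (wPlus i / Real.goldenRatio ^ (mu i + j))
        / Real.sin (Real.pi * (wPlus i / Real.goldenRatio ^ (mu i + j))) ^ σ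
      * (f 0 / (Real.pi ^ σ * (wythoffDual i (mu i + j) : ℝ) ^ σ))
    - rowLimit σ f i

/-- `δ_{f,σ}(i)`, a series over `k = 1, 2, …`. -/
def delta (σ : ℝ) (f : ℝ → ℝ) (i : ℕ) : ℝ := ∑' k : ℕ, deltaTerm σ f i (k + 1)

/-- `δ*_{f,σ}(i)`, a series over `j = 1, 2, …`. -/
def deltaDual (σ : ℝ) (f : ℝ → ℝ) (i : ℕ) : ℝ := ∑' j : ℕ, deltaDualTerm σ f i (j + 1)

/-- The `i`-th term of the series defining `D`. -/
def constDTerm (σ : ℝ) (f : ℝ → ℝ) (i : ℕ) : ℝ :=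
  delta σ f i + deltaDual σ f i
    - f 0 ^ 2 * (5 : ℝ) ^ (σ / 2) / Real.pi ^ (2 * σ) * (((mu i : ℝ) + 1) / eta i ^ σ)

/-- The constant `C`, a series over `i = 1, 2, …`. -/
def constC (σ : ℝ) (f : ℝ → ℝ) : ℝ :=
  2 * (f 0 ^ 2 * (5 : ℝ) ^ (σ / 2) / Real.pi ^ (2 * σ)) * ∑' i : ℕ, 1 / eta (i + 1) ^ σ

/-- The constant `D`, a series over `i = 1, 2, …`. -/
def constD (σ : ℝ) (f : ℝ → ℝ) : ℝ := 2 * ∑' i : ℕ, constDTerm σ f (i + 1)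

/-- The normalized sum over the Fibonacci lattice with `F_n` points (`n ≥ 1`). -/
def fibSum (σ : ℝ) (f : ℝ → ℝ) (n : ℕ) : ℝ :=
  1 / (Nat.fib n : ℝ) ^ σ * ∑ m ∈ Finset.Ico 1 (Nat.fib n),
    f ((m : ℝ) / (Nat.fib n : ℝ)) / |Real.sin (Real.pi * (m : ℝ) / (Nat.fib n : ℝ))| ^ σ
      * (f ((Nat.fib (n - 1) : ℝ) * (m : ℝ) / (Nat.fib n : ℝ))
          / |Real.sin (Real.pi * (Nat.fib (n - 1) : ℝ) * (m : ℝ) / (Nat.fib n : ℝ))| ^ σ)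

end

end FibLattice

/-!
The sum is organised by the arithmetic of `ℤ[φ]`. Write `θ_i = w₊*(i) = -w₋(i)`. Binet's formula
gives `√5 W_{i,k} = w₊(i) φ^k + θ_i ψ^k`, and the dual array satisfies the same formula with `w₊(i)`
and `θ_i` exchanged (`sqrt_five_mul_wythoff`, `sqrt_five_mul_wythoffDual`). Every positive integer
occurs exactly once in the Wythoff array (`exists_wythoff_eq`, `wythoff_injective`): the gap
`W_{i,k+1} - φ W_{i,k}` lies in `(φ - 2, φ - 1)`, an interval of length `1`, so an entry determines
its successor, and the gap is multiplied by `ψ` from one column to the next, so its size tells the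
column. The entries below `F_n / 2` are exactly those with `k + μ_i + 1 ≤ n`
(`two_mul_wythoff_lt_fib_iff`). As the summand is invariant under `m ↦ F_n - m`, the Fibonacci sum
is twice the sum over these pairs `(i, k)`, up to one negligible term (`fibSum_eq_sum_rows`).

Multiplication by `F_{n-1}` modulo `F_n` sends `W_{i,k}` to `± W*_{i,n-k}`. With
`h(x) = f(x) (π x / sin (π x))^σ` (`regPart`), `A = w₊(i) φ^{k-n}` and `B = θ_i φ^{-k}`, the summand
at `W_{i,k}` is therefore `5^{σ/2} / (π^{2σ} η_i^σ)` times `U V h(A) h(B)`, up to a shift of the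
arguments by `O(φ^{-n})`, where `U = 1 + O(φ^{-k})` and `V = 1 + O(φ^{-(n-k-μ_i)})`. The two
products in the terms of `δ` and of `δ*`, and the row limit, arise from the same product by
replacing `(V, A)`, `(U, B)`, or both, by `(1, 0)`, so the summand minus the row limit and the terms
of `δ` and `δ*` is the mixed difference
`(U h(B) - h(0)) (V h(A) - h(0))`, which is `O(φ^{-α (n - μ_i)})` by Hölder continuity
(`exists_mixed_difference_bound`, `exists_row_bounds`).

Summing over `k` gives the contribution of a row up to `O(n μ_i φ^{-α (n - μ_i)} η_i^{-σ})`
(`exists_abs_rowDefect_le`). Since `i ≤ φ^{μ_i} ≤ 10 η_i`, half of the exponent `min α (σ - 1)` can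
be given to the convergence of the sum over the rows and the other half is kept as decay in `n`
(`exists_abs_rowDefect_le_summable`). This bound also covers the rows that do not reach below
`F_n / 2`, that is, the tails of the series `C` and `D`.
-/

namespace FibLattice

open Real
open scoped goldenRatio

/-! ### The singularity of `1 / sin` -/

theorem exists_rpow_lipschitz (p : ℝ) {c d : ℝ} (hc : 0 < c) :
    ∃ K : ℝ, 0 ≤ K ∧ ∀ x ∈ Set.Icc c d, ∀ y ∈ Set.Icc c d, |x ^ p - y ^ p| ≤ K * |x - y| := by
  have hcont : ContinuousOn (fun x : ℝ => p * x ^ (p - 1)) (Set.Icc c d) := by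
    refine continuousOn_const.mul (continuousOn_id.rpow_const fun x hx => Or.inl ?_)
    exact (hc.trans_le hx.1).ne'
  obtain ⟨K, hK⟩ := isCompact_Icc.exists_bound_of_continuousOn hcont
  refine ⟨max K 0, le_max_right _ _, fun x hx y hy => ?_⟩
  have := (convex_Icc c d).norm_image_sub_le_of_norm_hasDerivWithin_le
    (f := fun x : ℝ => x ^ p) (f' := fun x : ℝ => p * x ^ (p - 1)) (C := max K 0)
    (fun z hz => (Real.hasDerivAt_rpow_const (Or.inl (hc.trans_le hz.1).ne')).hasDerivWithinAt)
    (fun z hz => (hK z hz).trans (le_max_left _ _)) hy hx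
  simpa [Real.norm_eq_abs] using this

theorem one_sub_sinc_le {x : ℝ} (hx : 0 ≤ x) : 1 - sinc x ≤ 2 * x := by
  rcases hx.eq_or_lt with rfl | hx
  · simp
  rcases le_or_gt x 1 with h1 | h1
  · have := Real.sin_gt_sub_cube hx
    rw [sinc_of_ne_zero hx.ne', sub_le_comm, le_div_iff₀ hx]
    nlinarith [mul_pos hx hx]
  · linarith [neg_one_le_sinc x]

/-- `sinc` is Lipschitz up to the origin, which is needed since both arguments of a term may be
small. -/
theorem abs_sinc_sub_sinc_le {x y : ℝ} (hx : 0 ≤ x) (hy : 0 ≤ y) :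
    |sinc x - sinc y| ≤ 2 * |x - y| := by
  rcases hx.eq_or_lt with rfl | hx
  · have h := one_sub_sinc_le hy
    have h1 := sinc_le_one y
    rw [sinc_zero, zero_sub, abs_neg, abs_of_nonneg hy, abs_of_nonneg] <;> linarith
  rcases hy.eq_or_lt with rfl | hy
  · have h := one_sub_sinc_le hx.le
    have h1 := sinc_le_one x
    rw [sinc_zero, sub_zero, abs_of_nonneg hx.le, abs_le]
    constructor <;> linarith
  have hd : ∀ t ∈ Set.Ioi (0 : ℝ), HasDerivWithinAt (fun t => sin t / t)
      ((cos t * t - sin t * 1) / t ^ 2) (Set.Ioi 0) t := fun t ht =>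
    ((Real.hasDerivAt_sin t).div (hasDerivAt_id t) (ne_of_gt ht)).hasDerivWithinAt
  have hb : ∀ t ∈ Set.Ioi (0 : ℝ), ‖(cos t * t - sin t * 1) / t ^ 2‖ ≤ 2 := by
    intro t ht
    have ht : 0 < t := ht
    rw [Real.norm_eq_abs, abs_div, abs_of_pos (pow_pos ht 2), div_le_iff₀ (pow_pos ht 2), abs_le]
    have hs := Real.sin_lt ht
    have hc := cos_le_one t
    have hc' := neg_one_le_cos t
    rcases le_or_gt t 1 with h1 | h1
    · have h3 := Real.sin_gt_sub_cube ht
      have h4 := Real.one_sub_sq_div_two_le_cos (x := t)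
      constructor
      · nlinarith [mul_le_mul_of_nonneg_right h4 ht.le, mul_pos ht ht]
      · nlinarith [mul_le_mul_of_nonneg_right hc ht.le, mul_pos ht ht]
    · have := neg_one_le_sin t
      have := sin_le_one t
      constructor
      · nlinarith [mul_le_mul_of_nonneg_right hc' ht.le]
      · nlinarith [mul_le_mul_of_nonneg_right hc ht.le]
  have := (convex_Ioi (0 : ℝ)).norm_image_sub_le_of_norm_hasDerivWithin_le hd hb
    (Set.mem_Ioi.2 hy) (Set.mem_Ioi.2 hx)
  simpa [Real.norm_eq_abs, sinc_of_ne_zero hx.ne', sinc_of_ne_zero hy.ne'] using this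

theorem sinc_lower {x : ℝ} (h0 : 0 ≤ x) (h1 : x ≤ 3 / 4) : 1 / 6 ≤ sinc (π * x) := by
  rcases h0.eq_or_lt with rfl | h0
  · norm_num
  have hpx : 0 < π * x := mul_pos pi_pos h0
  rw [sinc_of_ne_zero hpx.ne', le_div_iff₀ hpx]
  rcases le_or_gt x (1 / 2) with h | h
  · have := Real.mul_le_sin hpx.le (by nlinarith [pi_pos])
    have e : 2 / π * (π * x) = 2 * x := by field_simp
    nlinarith [pi_lt_four]
  · have := Real.mul_le_sin (x := π * (1 - x)) (by nlinarith [pi_pos]) (by nlinarith [pi_pos])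
    have e : 2 / π * (π * (1 - x)) = 2 * (1 - x) := by field_simp
    have e2 : sin (π * (1 - x)) = sin (π * x) := by rw [mul_sub, mul_one, sin_pi_sub]
    nlinarith [pi_lt_four]

/-- The regular part `f(x) (π x / sin (π x))^σ` of `f(x) / sin(π x)^σ` at the origin. -/
noncomputable def regPart (σ : ℝ) (f : ℝ → ℝ) (x : ℝ) : ℝ := f x * sinc (π * x) ^ (-σ)

theorem regPart_zero (σ : ℝ) (f : ℝ → ℝ) : regPart σ f 0 = f 0 := by simp [regPart]

theorem div_sin_rpow_eq (σ : ℝ) (f : ℝ → ℝ) {x : ℝ} (h0 : 0 < x) (h1 : x < 1) :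
    f x / sin (π * x) ^ σ = regPart σ f x * (π * x) ^ (-σ) := by
  have hpx : 0 < π * x := mul_pos pi_pos h0
  have hs : 0 < sin (π * x) := sin_pos_of_pos_of_lt_pi hpx (by nlinarith [pi_pos])
  rw [regPart, sinc_of_ne_zero hpx.ne', mul_assoc, ← mul_rpow (div_pos hs hpx).le hpx.le,
    div_mul_cancel₀ _ hpx.ne', rpow_neg hs.le, div_eq_mul_inv]

/-- The regular part inherits the Hölder continuity of `f` on the part of `[0, 1)` that stays away
from the pole of `1 / sin (π x)` at `1`. -/
theorem exists_regPart_bounds (σ : ℝ) {α : ℝ} (hα1 : α ≤ 1) {f : ℝ → ℝ} {L : ℝ}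
    (hL : 0 ≤ L) (hα0 : 0 < α)
    (hf : ∀ x ∈ Set.Ico (0 : ℝ) 1, ∀ y ∈ Set.Ico (0 : ℝ) 1, |f x - f y| ≤ L * |x - y| ^ α) :
    ∃ K : ℝ, 0 ≤ K ∧ (∀ x ∈ Set.Icc (0 : ℝ) (3 / 4), |regPart σ f x| ≤ K) ∧
      ∀ x ∈ Set.Icc (0 : ℝ) (3 / 4), ∀ y ∈ Set.Icc (0 : ℝ) (3 / 4),
        |regPart σ f x - regPart σ f y| ≤ K * |x - y| ^ α := by
  obtain ⟨K, hK0, hK⟩ := exists_rpow_lipschitz (-σ) (c := 1 / 6) (d := 1) (by norm_num)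
  have hmem : ∀ x ∈ Set.Icc (0 : ℝ) (3 / 4), sinc (π * x) ∈ Set.Icc (1 / 6 : ℝ) 1 :=
    fun x hx => ⟨sinc_lower hx.1 hx.2, sinc_le_one _⟩
  have hI : ∀ x ∈ Set.Icc (0 : ℝ) (3 / 4), x ∈ Set.Ico (0 : ℝ) 1 :=
    fun x hx => ⟨hx.1, by linarith [hx.2]⟩
  have hpow : ∀ x ∈ Set.Icc (0 : ℝ) (3 / 4), |sinc (π * x) ^ (-σ)| ≤ 1 + K := by
    intro x hx
    have h := hK _ (hmem x hx) 1 ⟨by norm_num, le_rfl⟩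
    rw [one_rpow] at h
    have h2 : |sinc (π * x) - 1| ≤ 1 := by
      rw [abs_le]; constructor <;> linarith [(hmem x hx).1, (hmem x hx).2]
    have h3 := abs_sub_abs_le_abs_sub (sinc (π * x) ^ (-σ)) 1
    rw [abs_one] at h3
    nlinarith
  have hbd : ∀ x ∈ Set.Icc (0 : ℝ) (3 / 4), |f x| ≤ |f 0| + L := by
    intro x hx
    have h := hf x (hI x hx) 0 (by simp)
    have h3 := abs_sub_abs_le_abs_sub (f x) (f 0)
    have h4 : |x - 0| ^ α ≤ 1 :=
      rpow_le_one (abs_nonneg _) (by rw [sub_zero, abs_of_nonneg hx.1]; linarith [hx.2]) hα0.le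
    nlinarith
  set B := |f 0| + L with hB
  have hB0 : 0 ≤ B := by positivity
  refine ⟨B * (1 + K) + (L * (1 + K) + B * (K * 8)), by positivity, fun x hx => ?_,
    fun x hx y hy => ?_⟩
  · rw [regPart, abs_mul]
    have := mul_le_mul (hbd x hx) (hpow x hx) (abs_nonneg _) hB0
    have : 0 ≤ L * (1 + K) + B * (K * 8) := by positivity
    linarith
  · have e : regPart σ f x - regPart σ f y = (f x - f y) * sinc (π * x) ^ (-σ)
        + f y * (sinc (π * x) ^ (-σ) - sinc (π * y) ^ (-σ)) := by simp only [regPart]; ring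
    have hxy : |x - y| ≤ 1 := by
      rw [abs_le]; constructor <;> linarith [hx.1, hx.2, hy.1, hy.2]
    have hle : |x - y| ≤ |x - y| ^ α := by
      rcases (abs_nonneg (x - y)).eq_or_lt with h | h
      · rw [← h]; exact rpow_nonneg le_rfl _
      · exact self_le_rpow_of_le_one h.le hxy hα1
    have h1 := mul_le_mul (hf x (hI x hx) y (hI y hy)) (hpow x hx) (abs_nonneg _) (by positivity)
    have h2 : |sinc (π * x) ^ (-σ) - sinc (π * y) ^ (-σ)| ≤ K * 8 * |x - y| := by
      refine (hK _ (hmem x hx) _ (hmem y hy)).trans ?_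
      have h3 := abs_sinc_sub_sinc_le (mul_nonneg pi_pos.le hx.1) (mul_nonneg pi_pos.le hy.1)
      rw [← mul_sub, abs_mul, abs_of_pos pi_pos] at h3
      rw [mul_assoc]
      refine mul_le_mul_of_nonneg_left (h3.trans ?_) hK0
      nlinarith [pi_lt_four, abs_nonneg (x - y)]
    have h4 := mul_le_mul (hbd y hy) (h2.trans (mul_le_mul_of_nonneg_left hle (by positivity)))
      (abs_nonneg _) hB0
    rw [e]
    refine (abs_add_le _ _).trans ?_
    rw [abs_mul, abs_mul]
    have h5 : 0 ≤ B * (1 + K) * |x - y| ^ α := by positivity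
    nlinarith

/-- Both single differences and the mixed second difference of `(A, B) ↦ h A * h B`, where `h` is
the regular part. The relative perturbations `u`, `v`, `e` and the shifts `A → x`, `B → y` are what
separates a term of the Fibonacci sum from its limits; the mixed difference factors as
`(U h(B) - h(0)) (V h(A) - h(0))` up to the shifts. -/
theorem exists_mixed_difference_bound (σ : ℝ) {α : ℝ} (hα0 : 0 < α) (hα1 : α ≤ 1) {f : ℝ → ℝ}
    {L : ℝ} (hL : 0 ≤ L)
    (hf : ∀ x ∈ Set.Ico (0 : ℝ) 1, ∀ y ∈ Set.Ico (0 : ℝ) 1, |f x - f y| ≤ L * |x - y| ^ α) :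
    ∃ C : ℝ, 0 ≤ C ∧
      (∀ A ∈ Set.Icc (0 : ℝ) (3 / 4), ∀ v p : ℝ, |v| ≤ 1 / 2 → A ^ α ≤ p → |v| ≤ p →
        |(1 + v) ^ (-σ) * regPart σ f A * f 0 - f 0 ^ 2| ≤ C * p) ∧
      (∀ A ∈ Set.Icc (0 : ℝ) (3 / 4), ∀ B ∈ Set.Icc (0 : ℝ) (3 / 4),
        ∀ x ∈ Set.Icc (0 : ℝ) (3 / 4), ∀ y ∈ Set.Icc (0 : ℝ) (3 / 4), ∀ u v e p q r : ℝ,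
        |u| ≤ 1 / 2 → |v| ≤ 1 / 2 → |e| ≤ 1 / 2 → A ^ α ≤ p → |v| ≤ p → B ^ α ≤ q → |u| ≤ q →
        |x - A| ^ α ≤ r → |y - B| ^ α ≤ r → |e| ≤ r →
        |(1 - e) ^ σ * (1 + u) ^ (-σ) * (1 + v) ^ (-σ) * (regPart σ f x * regPart σ f y)
          - (1 + u) ^ (-σ) * regPart σ f B * f 0 - (1 + v) ^ (-σ) * regPart σ f A * f 0
          + f 0 ^ 2| ≤ C * (p * q + r)) := by
  obtain ⟨H, hH0, hHb, hHl⟩ := exists_regPart_bounds σ hα1 hL hα0 hf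
  obtain ⟨K, hK0, hK⟩ := exists_rpow_lipschitz (-σ) (c := 1 / 2) (d := 3 / 2) (by norm_num)
  obtain ⟨K', hK0', hK'⟩ := exists_rpow_lipschitz σ (c := 1 / 2) (d := 3 / 2) (by norm_num)
  have hmem : ∀ v : ℝ, |v| ≤ 1 / 2 → 1 + v ∈ Set.Icc (1 / 2 : ℝ) (3 / 2) := by
    intro v hv
    rw [abs_le] at hv
    constructor <;> linarith
  have h1mem : (1 : ℝ) ∈ Set.Icc (1 / 2 : ℝ) (3 / 2) := by constructor <;> norm_num
  have hz : (0 : ℝ) ∈ Set.Icc (0 : ℝ) (3 / 4) := by constructor <;> norm_num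
  have hpow : ∀ v : ℝ, |v| ≤ 1 / 2 → |(1 + v) ^ (-σ) - 1| ≤ K * |v| := by
    intro v hv
    have := hK _ (hmem v hv) 1 h1mem
    rwa [one_rpow, add_sub_cancel_left] at this
  have hpowb : ∀ v : ℝ, |v| ≤ 1 / 2 → |(1 + v) ^ (-σ)| ≤ 1 + K := by
    intro v hv
    have h := hpow v hv
    have h3 := abs_sub_abs_le_abs_sub ((1 + v) ^ (-σ)) 1
    rw [abs_one] at h3
    nlinarith
  have hpow' : ∀ e : ℝ, |e| ≤ 1 / 2 → |(1 - e) ^ σ - 1| ≤ K' * |e| := by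
    intro v hv
    have := hK' _ (hmem (-v) (by rwa [abs_neg])) 1 h1mem
    rwa [one_rpow, add_sub_cancel_left, abs_neg, ← sub_eq_add_neg] at this
  have hpowb' : ∀ e : ℝ, |e| ≤ 1 / 2 → |(1 - e) ^ σ| ≤ 1 + K' := by
    intro v hv
    have h := hpow' v hv
    have h3 := abs_sub_abs_le_abs_sub ((1 - v) ^ σ) 1
    rw [abs_one] at h3
    nlinarith
  have hf0 : |f 0| ≤ H := by simpa [regPart_zero] using hHb 0 hz
  have single : ∀ A ∈ Set.Icc (0 : ℝ) (3 / 4), ∀ v p : ℝ, |v| ≤ 1 / 2 → A ^ α ≤ p → |v| ≤ p →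
      |(1 + v) ^ (-σ) * regPart σ f A - f 0| ≤ (K * H + H) * p := by
    intro A hA v p hv hAp hvp
    have e : (1 + v) ^ (-σ) * regPart σ f A - f 0 = ((1 + v) ^ (-σ) - 1) * regPart σ f A
        + (regPart σ f A - regPart σ f 0) := by rw [regPart_zero]; ring
    have h1 := mul_le_mul ((hpow v hv).trans (mul_le_mul_of_nonneg_left hvp hK0)) (hHb A hA)
      (abs_nonneg _) (mul_nonneg hK0 ((abs_nonneg _).trans hvp))
    have h2 := hHl A hA 0 hz
    rw [sub_zero, abs_of_nonneg hA.1] at h2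
    have h3 := mul_le_mul_of_nonneg_left hAp hH0
    rw [e]
    refine (abs_add_le _ _).trans ?_
    rw [abs_mul]
    linarith
  set M := 1 + K with hM
  set M' := 1 + K' with hM'
  have hM0 : 0 ≤ M := by positivity
  have hM0' : 0 ≤ M' := by positivity
  set C1 := K * H + H with hC1
  have hC10 : 0 ≤ C1 := by positivity
  set C2 := K' * M * M * (H * H) + M * M * (H * H) + M * M * (H * H) with hC2
  have hC20 : 0 ≤ C2 := by positivity
  refine ⟨C1 * H + C1 * C1 + C2, by positivity, ?_, ?_⟩
  · intro A hA v p hv hAp hvp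
    have hp : 0 ≤ p := (abs_nonneg _).trans hvp
    have e : (1 + v) ^ (-σ) * regPart σ f A * f 0 - f 0 ^ 2
        = ((1 + v) ^ (-σ) * regPart σ f A - f 0) * f 0 := by ring
    have h1 := mul_le_mul (single A hA v p hv hAp hvp) hf0 (abs_nonneg _) (by positivity)
    rw [e, abs_mul]
    have : 0 ≤ (C1 * C1 + C2) * p := by positivity
    nlinarith
  · intro A hA B hB x hx y hy u v e p q r hu hv he hAp hvp hBq huq hxr hyr her
    have hp : 0 ≤ p := (abs_nonneg _).trans hvp
    have hq : 0 ≤ q := (abs_nonneg _).trans huq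
    have hr : 0 ≤ r := (abs_nonneg _).trans her
    have hU := hpowb u hu
    have hV := hpowb v hv
    have hE := hpow' e he
    have sA := single A hA v p hv hAp hvp
    have sB := single B hB u q hu hBq huq
    have hx' := hHl x hx A hA
    have hy' := hHl y hy B hB
    set U := (1 + u) ^ (-σ)
    set V := (1 + v) ^ (-σ)
    set E := (1 - e) ^ σ
    have key : E * U * V * (regPart σ f x * regPart σ f y)
          - U * regPart σ f B * f 0 - V * regPart σ f A * f 0 + f 0 ^ 2
        = (U * regPart σ f B - f 0) * (V * regPart σ f A - f 0)
          + ((E - 1) * U * V * (regPart σ f x * regPart σ f y)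
            + U * V * ((regPart σ f x - regPart σ f A) * regPart σ f y)
            + U * V * (regPart σ f A * (regPart σ f y - regPart σ f B))) := by ring
    have t0 : |(U * regPart σ f B - f 0) * (V * regPart σ f A - f 0)| ≤ (C1 * q) * (C1 * p) := by
      rw [abs_mul]; gcongr
    have t1 : |(E - 1) * U * V * (regPart σ f x * regPart σ f y)|
        ≤ (K' * r) * M * M * (H * H) := by
      simp only [abs_mul]
      gcongr
      · exact hE.trans (by gcongr)
      · exact hHb x hx
      · exact hHb y hy
    have t2 : |U * V * ((regPart σ f x - regPart σ f A) * regPart σ f y)|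
        ≤ M * M * ((H * r) * H) := by
      simp only [abs_mul]
      gcongr
      · exact hx'.trans (by gcongr)
      · exact hHb y hy
    have t3 : |U * V * (regPart σ f A * (regPart σ f y - regPart σ f B))|
        ≤ M * M * (H * (H * r)) := by
      simp only [abs_mul]
      gcongr
      · exact hHb A hA
      · exact hy'.trans (by gcongr)
    rw [key]
    have a0 := abs_add_le ((U * regPart σ f B - f 0) * (V * regPart σ f A - f 0))
      ((E - 1) * U * V * (regPart σ f x * regPart σ f y)
            + U * V * ((regPart σ f x - regPart σ f A) * regPart σ f y)
            + U * V * (regPart σ f A * (regPart σ f y - regPart σ f B)))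
    have a1 := abs_add_three ((E - 1) * U * V * (regPart σ f x * regPart σ f y))
      (U * V * ((regPart σ f x - regPart σ f A) * regPart σ f y))
      (U * V * (regPart σ f A * (regPart σ f y - regPart σ f B)))
    have g1 : 0 ≤ C1 * H * (p * q) := by positivity
    have g2 : 0 ≤ C2 * (p * q) := by positivity
    have g3 : 0 ≤ C1 * H * r := by positivity
    have g4 : 0 ≤ C1 * C1 * r := by positivity
    have g5 : C2 * r = K' * r * M * M * (H * H) + M * M * (H * r * H) + M * M * (H * (H * r)) := by
      rw [hC2]; ring
    have g6 : C1 * q * (C1 * p) = C1 * C1 * (p * q) := by ring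
    linarith [show (C1 * H + C1 * C1 + C2) * (p * q + r) = C1 * H * (p * q) + C1 * C1 * (p * q)
      + C2 * (p * q) + C1 * H * r + C1 * C1 * r + C2 * r by ring]

/-! ### The Wythoff array -/

theorem goldenRatio_gt : (8 / 5 : ℝ) < φ := by
  nlinarith [goldenRatio_sq, goldenRatio_pos]

theorem goldenRatio_lt : φ < (13 / 8 : ℝ) := by
  nlinarith [goldenRatio_sq, goldenRatio_pos]

theorem goldenConj_eq : ψ = 1 - φ := one_sub_goldenConj.symm

theorem sqrt_five_eq : √5 = 2 * φ - 1 := by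
  rw [← goldenRatio_sub_goldenConj, goldenConj_eq]; ring

theorem inv_goldenRatio_eq : φ⁻¹ = φ - 1 := by
  rw [inv_goldenRatio, goldenConj_eq]; ring

theorem int_eq_goldenRatio_mul_int {a b : ℤ} (h : (a : ℝ) = φ * b) : b = 0 := by
  by_contra hb
  refine (goldenRatio_irrational.mul_intCast hb).ne_int a h.symm

/-- The conjugate weight `w₊*(i) = -w₋(i)`. -/
noncomputable def wPlusStar (i : ℕ) : ℝ := -wMinus i

theorem eta_eq (i : ℕ) : eta i = wPlus i * wPlusStar i := by rw [eta, wPlusStar]; ring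

/-- With `a = ⌊φ i⌋`, row `i` starts with `i + a - 1` and `i + 2 a - 1`. -/
theorem wythoff_initial {i : ℕ} (hi : 1 ≤ i) : ∃ a : ℤ, 1 ≤ a ∧ wythoff i 1 = i + a - 1 ∧
    wythoff i 2 = i + 2 * a - 1 ∧ 0 < φ * i - a ∧ φ * i - a < 1 := by
  have hle := Int.floor_le (φ * (i : ℝ))
  have hlt := Int.lt_floor_add_one (φ * (i : ℝ))
  have hi' : (1 : ℝ) ≤ i := by exact_mod_cast hi
  obtain ⟨a, ha⟩ : ∃ a : ℤ, a = ⌊φ * (i : ℝ)⌋ := ⟨_, rfl⟩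
  rw [← ha] at hle hlt
  have hne : (a : ℝ) ≠ φ * i := by
    intro h
    have := int_eq_goldenRatio_mul_int (a := a) (b := i) (by exact_mod_cast h)
    omega
  have hlt' : (a : ℝ) < φ * i := lt_of_le_of_ne hle hne
  have h8 := goldenRatio_gt
  have h13 := goldenRatio_lt
  have ha1 : 1 ≤ a := by
    have : (0 : ℝ) < a := by nlinarith
    exact_mod_cast this
  have hsq := goldenRatio_sq
  have e1 : φ * a = (i : ℝ) + a - (φ - 1) * (φ * i - a) := by linear_combination (i : ℝ) * hsq
  have b1 : 0 < (φ - 1) * (φ * i - a) := mul_pos (by linarith) (by linarith)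
  have b2 : (φ - 1) * (φ * i - a) < 1 := by nlinarith
  have f1 : ⌊φ * (a : ℝ)⌋ = i + a - 1 := by
    rw [Int.floor_eq_iff]
    push_cast
    constructor <;> linarith
  have f2 : ⌊φ ^ 2 * (a : ℝ)⌋ = i + 2 * a - 1 := by
    rw [Int.floor_eq_iff, hsq]
    push_cast
    constructor <;> linarith
  refine ⟨a, ha1, ?_, ?_, by linarith, by linarith⟩
  · simp only [wythoff, ← ha]; exact f1
  · simp only [wythoff, ← ha]; exact f2

theorem wythoff_one_pos {i : ℕ} (hi : 1 ≤ i) : 1 ≤ wythoff i 1 := by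
  obtain ⟨a, ha, h1, -⟩ := wythoff_initial hi
  omega

theorem wythoff_two_ge {i : ℕ} (hi : 1 ≤ i) : 2 ≤ wythoff i 2 := by
  obtain ⟨a, ha, -, h1, -⟩ := wythoff_initial hi
  omega

theorem le_wythoff_one {i : ℕ} (hi : 1 ≤ i) : (i : ℤ) ≤ wythoff i 1 := by
  obtain ⟨a, ha, h1, -⟩ := wythoff_initial hi
  omega

theorem wPlusStar_eq (i : ℕ) : wPlusStar i = φ * (wythoff i 2 - φ * wythoff i 1) := by
  rw [wPlusStar, wMinus]; ring

theorem wPlus_eq (i : ℕ) : wPlus i = (φ - 1) * (wythoff i 2 + (φ - 1) * wythoff i 1) := by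
  rw [wPlus, div_eq_mul_inv, div_eq_mul_inv, ← inv_pow, inv_goldenRatio_eq]; ring

theorem wythoff_initial_gap {i : ℕ} (hi : 1 ≤ i) :
    2 * φ - 3 < (wythoff i 2 : ℝ) - φ * wythoff i 1 ∧
      (wythoff i 2 : ℝ) - φ * wythoff i 1 < φ - 1 := by
  obtain ⟨a, ha, h1, h2, h3, h4⟩ := wythoff_initial hi
  have hsq := goldenRatio_sq
  have h8 := goldenRatio_gt
  have h13 := goldenRatio_lt
  have e : (wythoff i 2 : ℝ) - φ * wythoff i 1 = (φ - 1) - (2 - φ) * (φ * i - a) := by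
    rw [h1, h2]; push_cast; linear_combination (-i : ℝ) * hsq
  rw [e]
  constructor <;> nlinarith

theorem wPlusStar_gt {i : ℕ} (hi : 1 ≤ i) : 2 - φ < wPlusStar i := by
  rw [wPlusStar_eq]
  nlinarith [(wythoff_initial_gap hi).1, goldenRatio_sq, goldenRatio_gt]

theorem wPlusStar_lt_one {i : ℕ} (hi : 1 ≤ i) : wPlusStar i < 1 := by
  rw [wPlusStar_eq]
  nlinarith [(wythoff_initial_gap hi).2, goldenRatio_sq, goldenRatio_gt]

theorem wPlusStar_pos {i : ℕ} (hi : 1 ≤ i) : 0 < wPlusStar i := by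
  linarith [wPlusStar_gt hi, goldenRatio_lt]

theorem one_le_wPlus {i : ℕ} (hi : 1 ≤ i) : 1 ≤ wPlus i := by
  rw [wPlus_eq]
  have h1 : (1 : ℝ) ≤ wythoff i 1 := by exact_mod_cast wythoff_one_pos hi
  have h2 : (2 : ℝ) ≤ wythoff i 2 := by exact_mod_cast wythoff_two_ge hi
  have h8 := goldenRatio_gt
  nlinarith [mul_nonneg (by linarith : (0 : ℝ) ≤ φ - 1) (by linarith : (0 : ℝ) ≤ wythoff i 2 - 2),
    mul_nonneg (sq_nonneg (φ - 1)) (by linarith : (0 : ℝ) ≤ wythoff i 1 - 1)]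

theorem eta_pos {i : ℕ} (hi : 1 ≤ i) : 0 < eta i := by
  rw [eta_eq]
  exact mul_pos (by linarith [one_le_wPlus hi]) (wPlusStar_pos hi)

/-- Binet's formula for the rows of the Wythoff array. -/
theorem sqrt_five_mul_wythoff (i k : ℕ) :
    √5 * wythoff i (k + 1) = wPlus i * φ ^ (k + 1) + wPlusStar i * ψ ^ (k + 1) := by
  have hsq := goldenRatio_sq
  rw [wPlus_eq, wPlusStar_eq, sqrt_five_eq, goldenConj_eq]
  generalize φ = x at *
  induction k using Nat.twoStepInduction with
  | zero => linear_combination (-(2 * x - 1) * (wythoff i 1 : ℝ)) * hsq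
  | one => linear_combination (-(2 * x - 1) * (wythoff i 2 : ℝ)) * hsq
  | more k h1 h2 =>
    rw [wythoff_add_two i (k + 1)]
    push_cast
    rw [mul_add, h1, h2]
    linear_combination (-((x - 1) * (wythoff i 2 + (x - 1) * wythoff i 1) * x ^ (k + 1)
      + x * (wythoff i 2 - x * wythoff i 1) * (1 - x) ^ (k + 1))) * hsq

/-- Binet's formula for the dual array: conjugation exchanges the two weights. -/
theorem sqrt_five_mul_wythoffDual (i m : ℕ) :
    √5 * wythoffDual i m = wPlusStar i * φ ^ m + wPlus i * ψ ^ m := by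
  have hs : √5 ≠ 0 := by positivity
  have e1 : √5 * (Nat.fib (m + 1) : ℝ) = φ ^ (m + 1) - ψ ^ (m + 1) := by
    rw [coe_fib_eq]; field_simp
  have e2 : √5 * (Nat.fib (m + 2) : ℝ) = φ ^ (m + 2) - ψ ^ (m + 2) := by
    rw [coe_fib_eq]; field_simp
  rw [wythoffDual]
  push_cast
  rw [mul_sub, ← mul_assoc, ← mul_assoc, e1, e2, wPlus_eq, wPlusStar_eq, goldenConj_eq]
  ring

theorem wythoff_gap_succ (i k : ℕ) :
    (wythoff i (k + 2) : ℝ) - φ * wythoff i (k + 1)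
      = -(φ - 1) * ((wythoff i (k + 1) : ℝ) - φ * wythoff i k) := by
  rw [wythoff_add_two]
  push_cast
  linear_combination (- (wythoff i k : ℝ)) * goldenRatio_sq

/-- The gaps of all columns lie in an open interval of length `1`, so an entry determines the next
one. -/
theorem wythoff_gap {i : ℕ} (hi : 1 ≤ i) (k : ℕ) :
    φ - 2 < (wythoff i (k + 2) : ℝ) - φ * wythoff i (k + 1) ∧
      (wythoff i (k + 2) : ℝ) - φ * wythoff i (k + 1) < φ - 1 := by
  have hsq := goldenRatio_sq
  have h8 := goldenRatio_gt
  have h13 := goldenRatio_lt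
  induction k with
  | zero => exact ⟨by linarith [(wythoff_initial_gap hi).1], (wythoff_initial_gap hi).2⟩
  | succ k ih =>
    rw [wythoff_gap_succ]
    constructor <;> nlinarith [ih.1, ih.2]

/-- The gaps beyond the first column stay below those of the first column. -/
theorem wythoff_gap_lt {i : ℕ} (hi : 1 ≤ i) (k : ℕ) :
    (wythoff i (k + 3) : ℝ) - φ * wythoff i (k + 2) < 2 * φ - 3 := by
  rw [wythoff_gap_succ]
  nlinarith [(wythoff_gap hi k).1, goldenRatio_sq, goldenRatio_gt]

theorem fib_le_wythoff {i : ℕ} (hi : 1 ≤ i) (k : ℕ) :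
    (Nat.fib (k + 2) : ℤ) ≤ wythoff i (k + 1) := by
  induction k using Nat.twoStepInduction with
  | zero => exact wythoff_one_pos hi
  | one => exact wythoff_two_ge hi
  | more k h1 h2 =>
    rw [wythoff_add_two i (k + 1), Nat.fib_add_two (n := k + 2)]
    push_cast
    linarith

theorem wythoff_pos {i : ℕ} (hi : 1 ≤ i) (k : ℕ) : 0 < wythoff i (k + 1) :=
  lt_of_lt_of_le (by exact_mod_cast Nat.fib_pos.2 (by omega)) (fib_le_wythoff hi k)

/-- A pair whose gap is in the range of the first column, which is `(2 φ - 3, φ - 1) = (φ⁻³, φ⁻¹)`,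
starts row `2 m - m' + 1`. -/
theorem exists_wythoff_initial {m m' : ℤ} (hm : 1 ≤ m) (h1 : 2 * φ - 3 < (m' : ℝ) - φ * m)
    (h2 : (m' : ℝ) - φ * m < φ - 1) :
    ∃ i : ℕ, 1 ≤ i ∧ m = wythoff i 1 ∧ m' = wythoff i 2 := by
  have hsq := goldenRatio_sq
  have h8 := goldenRatio_gt
  have h13 := goldenRatio_lt
  have hm' : (1 : ℝ) ≤ m := by exact_mod_cast hm
  have hpos : 0 < 2 * m - m' + 1 := by
    have : (0 : ℝ) < ((2 * m - m' + 1 : ℤ) : ℝ) := by push_cast; nlinarith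
    exact_mod_cast this
  obtain ⟨i, hi⟩ := Int.eq_ofNat_of_zero_le hpos.le
  have hi1 : 1 ≤ i := by omega
  obtain ⟨a, ha, w1, w2, b1, b2⟩ := wythoff_initial hi1
  have hir : (i : ℝ) = 2 * m - m' + 1 := by exact_mod_cast hi.symm
  have c1 : 0 < φ * i - (m' - m : ℝ) := by rw [hir]; nlinarith
  have c2 : φ * i - (m' - m : ℝ) < 1 := by rw [hir]; nlinarith
  have hle : a < m' - m + 1 := by
    have : (a : ℝ) < ((m' - m + 1 : ℤ) : ℝ) := by push_cast; linarith
    exact_mod_cast this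
  have hge : m' - m < a + 1 := by
    have : ((m' - m : ℤ) : ℝ) < ((a + 1 : ℤ) : ℝ) := by push_cast; linarith
    exact_mod_cast this
  exact ⟨i, hi1, by omega, by omega⟩

/-- Stepping back along the Fibonacci recurrence keeps the gap `m' - φ m` in the admissible
interval until a first column is reached. -/
theorem exists_wythoff_of_gap (N : ℕ) : ∀ m m' : ℤ, 1 ≤ m → m ≤ N →
    φ - 2 < (m' : ℝ) - φ * m → (m' : ℝ) - φ * m < φ - 1 →
    ∃ i k : ℕ, 1 ≤ i ∧ m = wythoff i (k + 1) ∧ m' = wythoff i (k + 2) := by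
  induction N with
  | zero => intro m m' h1 h2; norm_num at h2; omega
  | succ N ih =>
    intro m m' hm hmN h1 h2
    have hsq := goldenRatio_sq
    have h8 := goldenRatio_gt
    have h13 := goldenRatio_lt
    have hm' : (1 : ℝ) ≤ m := by exact_mod_cast hm
    rcases lt_trichotomy (2 * φ - 3) ((m' : ℝ) - φ * m) with h | h | h
    · obtain ⟨i, hi, e1, e2⟩ := exists_wythoff_initial hm h h2
      exact ⟨i, 0, hi, e1, e2⟩
    · have := int_eq_goldenRatio_mul_int (a := m' + 3) (b := m + 2) (by push_cast; linarith)
      omega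
    · have hp : 0 < m' - m := by
        have : (0 : ℝ) < ((m' - m : ℤ) : ℝ) := by push_cast; nlinarith
        exact_mod_cast this
      have hlt : m' - m < m := by
        have : ((m' - m : ℤ) : ℝ) < m := by push_cast; nlinarith
        exact_mod_cast this
      push_cast at hmN
      obtain ⟨i, k, hi, e1, e2⟩ := ih (m' - m) m (by omega) (by omega)
        (by push_cast; nlinarith) (by push_cast; nlinarith)
      exact ⟨i, k + 1, hi, e2, by rw [wythoff_add_two i (k + 1), ← e1, ← e2]; ring⟩

theorem exists_wythoff_eq {m : ℤ} (hm : 1 ≤ m) : ∃ i k : ℕ, 1 ≤ i ∧ m = wythoff i (k + 1) := by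
  have h1 := Int.floor_le (φ * (m : ℝ) + φ - 1)
  have h2 := Int.lt_floor_add_one (φ * (m : ℝ) + φ - 1)
  obtain ⟨m', hm'⟩ : ∃ a : ℤ, a = ⌊φ * (m : ℝ) + φ - 1⌋ := ⟨_, rfl⟩
  rw [← hm'] at h1 h2
  have hne : (m' : ℝ) - φ * m ≠ φ - 1 := by
    intro h
    have := int_eq_goldenRatio_mul_int (a := m' + 1) (b := m + 1) (by push_cast; linarith)
    omega
  obtain ⟨i, k, hi, e, -⟩ := exists_wythoff_of_gap m.toNat m m' hm (by omega) (by linarith)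
    (lt_of_le_of_ne (by linarith) hne)
  exact ⟨i, k, hi, e⟩

theorem wythoff_succ_eq_of_eq {i i' k k' : ℕ} (hi : 1 ≤ i) (hi' : 1 ≤ i')
    (h : wythoff i (k + 1) = wythoff i' (k' + 1)) : wythoff i (k + 2) = wythoff i' (k' + 2) := by
  obtain ⟨a1, a2⟩ := wythoff_gap hi k
  obtain ⟨b1, b2⟩ := wythoff_gap hi' k'
  rw [h] at a1 a2
  have hle : wythoff i (k + 2) < wythoff i' (k' + 2) + 1 := by
    have : (wythoff i (k + 2) : ℝ) < ((wythoff i' (k' + 2) + 1 : ℤ) : ℝ) := by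
      push_cast; linarith
    exact_mod_cast this
  have hge : wythoff i' (k' + 2) < wythoff i (k + 2) + 1 := by
    have : (wythoff i' (k' + 2) : ℝ) < ((wythoff i (k + 2) + 1 : ℤ) : ℝ) := by
      push_cast; linarith
    exact_mod_cast this
  omega

theorem wythoff_injective {i i' : ℕ} (hi : 1 ≤ i) (hi' : 1 ≤ i') : ∀ k k' : ℕ,
    wythoff i (k + 1) = wythoff i' (k' + 1) → i = i' ∧ k = k' := by
  intro k
  induction k with
  | zero =>
    intro k' h
    have h2 := wythoff_succ_eq_of_eq hi hi' h
    cases k' with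
    | zero =>
      obtain ⟨a, -, w1, w2, -⟩ := wythoff_initial hi
      obtain ⟨b, -, v1, v2, -⟩ := wythoff_initial hi'
      simp only [zero_add] at h h2
      omega
    | succ k' =>
      have h3 := wythoff_gap_lt hi' k'
      have h4 := (wythoff_initial_gap hi).1
      simp only [zero_add] at h h2
      rw [h, h2] at h4
      linarith
  | succ k ih =>
    intro k' h
    have h2 := wythoff_succ_eq_of_eq hi hi' h
    cases k' with
    | zero =>
      have h3 := wythoff_gap_lt hi k
      have h4 := (wythoff_initial_gap hi').1
      simp only [zero_add] at h h2
      rw [← h, ← h2] at h4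
      linarith
    | succ k' =>
      have e1 := wythoff_add_two i (k + 1)
      have e2 := wythoff_add_two i' (k' + 1)
      have := ih k' (by omega)
      omega

theorem abs_goldenConj_pow_le {m : ℕ} (hm : 3 ≤ m) : |ψ ^ m| ≤ 2 * φ - 3 := by
  have h8 := goldenRatio_gt
  have h13 := goldenRatio_lt
  rw [abs_pow, goldenConj_eq, abs_of_neg (by linarith)]
  refine (pow_le_pow_of_le_one (by linarith) (by linarith) hm).trans (le_of_eq ?_)
  linear_combination (φ - 2) * goldenRatio_sq

/-- `F_{m+k+2} - 2 W_{i,k+1}` satisfies the Fibonacci recurrence in `k`, and its first two values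
have the same sign: the gap of the first column and the correction `ψ^{m+2}` are too small for the sign
of an integer to change. -/
theorem two_mul_wythoff_lt_fib_iff_first {i : ℕ} (hi : 1 ≤ i) {m : ℕ} (hm : 1 ≤ m) (k : ℕ) :
    2 * wythoff i (k + 1) < (Nat.fib (m + k + 2) : ℤ) ↔
      2 * wythoff i 1 < (Nat.fib (m + 2) : ℤ) := by
  obtain ⟨g1, g2⟩ := wythoff_initial_gap hi
  have h8 := goldenRatio_gt
  have h13 := goldenRatio_lt
  have hp := abs_le.1 (abs_goldenConj_pow_le (m := m + 2) (by omega))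
  have hf := fib_succ_sub_goldenRatio_mul_fib (m + 2)
  have e3 : ∀ k, m + (k + 2) + 2 = m + k + 2 + 2 := fun k => by ring
  have e4 : ∀ k, m + (k + 1) + 2 = m + k + 2 + 1 := fun k => by ring
  constructor
  · contrapose!
    intro h
    have h2 : (Nat.fib (m + 2 + 1) : ℤ) ≤ 2 * wythoff i 2 := by
      have hr : (Nat.fib (m + 2) : ℝ) ≤ 2 * wythoff i 1 := by exact_mod_cast h
      have : (Nat.fib (m + 2 + 1) : ℝ) ≤ 2 * wythoff i 2 := by nlinarith
      exact_mod_cast this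
    induction k using Nat.twoStepInduction with
    | zero => exact h
    | one => exact h2
    | more k i1 i2 =>
      rw [wythoff_add_two i (k + 1), e3, Nat.fib_add_two]
      rw [e4] at i2
      push_cast
      linarith
  · intro h
    have h2 : 2 * wythoff i 2 < (Nat.fib (m + 2 + 1) : ℤ) := by
      have hr : 2 * (wythoff i 1 : ℝ) + 1 ≤ (Nat.fib (m + 2) : ℝ) := by exact_mod_cast h
      have : 2 * (wythoff i 2 : ℝ) < (Nat.fib (m + 2 + 1) : ℝ) := by nlinarith
      exact_mod_cast this
    induction k using Nat.twoStepInduction with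
    | zero => exact h
    | one => exact h2
    | more k i1 i2 =>
      rw [wythoff_add_two i (k + 1), e3, Nat.fib_add_two]
      rw [e4] at i2
      push_cast
      linarith

theorem goldenRatio_pow_le_fib (n : ℕ) : φ ^ n ≤ Nat.fib (n + 2) := by
  induction n using Nat.twoStepInduction with
  | zero => simp
  | one => norm_num [Nat.fib]; linarith [goldenRatio_lt]
  | more n h1 h2 =>
    rw [Nat.fib_add_two (n := n + 2)]
    push_cast
    have : φ ^ (n + 2) = φ ^ n + φ ^ (n + 1) := by linear_combination φ ^ n * goldenRatio_sq
    linarith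

theorem fib_le_goldenRatio_pow (n : ℕ) : (Nat.fib (n + 1) : ℝ) ≤ φ ^ n := by
  induction n using Nat.twoStepInduction with
  | zero => simp
  | one => norm_num [Nat.fib]; linarith [goldenRatio_gt]
  | more n h1 h2 =>
    rw [Nat.fib_add_two (n := n + 1)]
    push_cast
    have : φ ^ (n + 2) = φ ^ n + φ ^ (n + 1) := by linear_combination φ ^ n * goldenRatio_sq
    linarith

theorem mu_set_nonempty (i : ℕ) :
    {m : ℕ | 1 ≤ m ∧ (wythoff i 1 : ℝ) < (Nat.fib (m + 2) : ℝ) / 2}.Nonempty := by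
  obtain ⟨n, hn⟩ := pow_unbounded_of_one_lt (2 * (wythoff i 1 : ℝ)) one_lt_goldenRatio
  refine ⟨n + 1, by omega, ?_⟩
  have h1 := goldenRatio_pow_le_fib n
  have h2 : (Nat.fib (n + 2) : ℝ) ≤ Nat.fib (n + 1 + 2) := by
    exact_mod_cast Nat.fib_mono (by omega)
  linarith

theorem mu_spec (i : ℕ) : 1 ≤ mu i ∧ 2 * wythoff i 1 < (Nat.fib (mu i + 2) : ℤ) := by
  obtain ⟨h1, h2⟩ := Nat.sInf_mem (mu_set_nonempty i)
  refine ⟨h1, ?_⟩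
  change (wythoff i 1 : ℝ) < (Nat.fib (mu i + 2) : ℝ) / 2 at h2
  have : 2 * (wythoff i 1 : ℝ) < (Nat.fib (mu i + 2) : ℝ) := by linarith
  exact_mod_cast this

theorem mu_le_iff (i m : ℕ) (hm : 1 ≤ m) : mu i ≤ m ↔ 2 * wythoff i 1 < (Nat.fib (m + 2) : ℤ) := by
  constructor
  · intro h
    refine (mu_spec i).2.trans_le ?_
    exact_mod_cast Nat.fib_mono (by omega)
  · intro h
    refine Nat.sInf_le ⟨hm, ?_⟩
    have : 2 * (wythoff i 1 : ℝ) < (Nat.fib (m + 2) : ℝ) := by exact_mod_cast h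
    linarith

theorem two_le_mu {i : ℕ} (hi : 1 ≤ i) : 2 ≤ mu i := by
  by_contra h
  have h1 := (mu_le_iff i 1 le_rfl).1 (by omega)
  have h2 := wythoff_one_pos hi
  norm_num [Nat.fib] at h1
  omega

/-- The entries below `F_n / 2` are those in the columns `1, …, n - μ_i - 1`. -/
theorem two_mul_wythoff_lt_fib_iff {i : ℕ} (hi : 1 ≤ i) (k n : ℕ) :
    2 * wythoff i (k + 1) < (Nat.fib n : ℤ) ↔ mu i + k + 2 ≤ n := by
  rcases le_or_gt n (k + 2) with h | h
  · have h1 := fib_le_wythoff hi k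
    have h2 : (Nat.fib n : ℤ) ≤ Nat.fib (k + 2) := by exact_mod_cast Nat.fib_mono h
    have h3 := wythoff_pos hi k
    have h4 := two_le_mu hi
    constructor <;> intro <;> omega
  · obtain ⟨m, rfl⟩ : ∃ m, n = m + k + 2 := ⟨n - (k + 2), by omega⟩
    rw [two_mul_wythoff_lt_fib_iff_first hi (by omega), ← mu_le_iff i m (by omega)]
    omega

/-- The clean constant uses that `2 W_{i,1} < F_{μ_i+2}` is a strict inequality of integers, which
outweighs the conjugate terms in Binet's formula. -/
theorem wPlus_le {i : ℕ} (hi : 1 ≤ i) : wPlus i ≤ φ ^ (mu i + 1) / 2 := by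
  have h8 := goldenRatio_gt
  have h13 := goldenRatio_lt
  have hsq := goldenRatio_sq
  have h1 : 2 * (wythoff i 1 : ℝ) + 1 ≤ (Nat.fib (mu i + 2) : ℝ) := by
    exact_mod_cast (mu_spec i).2
  have h2 := sqrt_five_mul_wythoff i 0
  have h3 : √5 * (Nat.fib (mu i + 2) : ℝ) = φ ^ (mu i + 2) - ψ ^ (mu i + 2) := by
    rw [coe_fib_eq]; field_simp
  have hp := abs_le.1 (abs_goldenConj_pow_le (m := mu i + 2) (by linarith [(mu_spec i).1]))
  rw [sqrt_five_eq] at h2 h3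
  rw [goldenConj_eq] at h2
  simp only [zero_add, pow_one] at h2
  have h4 := wPlusStar_lt_one hi
  have h5 : φ * (2 * wPlus i) ≤ φ * φ ^ (mu i + 1) := by
    rw [← pow_succ']
    nlinarith
  linarith [le_of_mul_le_mul_left h5 goldenRatio_pos]

theorem goldenRatio_pow_mu_le {i : ℕ} (hi : 1 ≤ i) : φ ^ mu i ≤ 10 * eta i := by
  have h8 := goldenRatio_gt
  have h13 := goldenRatio_lt
  have hsq := goldenRatio_sq
  obtain ⟨m, hm⟩ : ∃ m, mu i = m + 2 := ⟨mu i - 2, by have := two_le_mu hi; omega⟩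
  have h1 : ¬ 2 * wythoff i 1 < (Nat.fib (m + 3) : ℤ) := by
    rw [← mu_le_iff i (m + 1) (by omega)]; omega
  have h2 : (Nat.fib (m + 1 + 2) : ℝ) ≤ 2 * wythoff i 1 := by exact_mod_cast not_lt.1 h1
  have h3 := goldenRatio_pow_le_fib (m + 1)
  have h4 := sqrt_five_mul_wythoff i 0
  rw [sqrt_five_eq, goldenConj_eq] at h4
  simp only [zero_add, pow_one] at h4
  have h5 := wPlusStar_gt hi
  have h6 := one_le_wPlus hi
  have hW : (wythoff i 1 : ℝ) ≤ wPlus i := by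
    have : (1 : ℝ) ≤ wythoff i 1 := by exact_mod_cast wythoff_one_pos hi
    nlinarith
  have h7 : φ ^ (m + 2) = φ * φ ^ (m + 1) := pow_succ' _ _
  rw [hm, eta_eq, h7]
  have h9 : φ * φ ^ (m + 1) ≤ φ * (2 * wPlus i) :=
    mul_le_mul_of_nonneg_left (by linarith) (by linarith)
  nlinarith

theorem index_le_goldenRatio_pow_mu {i : ℕ} (hi : 1 ≤ i) : (i : ℝ) ≤ φ ^ mu i := by
  have h1 : (i : ℝ) ≤ wythoff i 1 := by exact_mod_cast le_wythoff_one hi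
  have h2 : 2 * (wythoff i 1 : ℝ) < (Nat.fib (mu i + 1 + 1) : ℝ) := by
    exact_mod_cast (mu_spec i).2
  have h3 := fib_le_goldenRatio_pow (mu i + 1)
  rw [pow_succ] at h3
  nlinarith [goldenRatio_lt, pow_pos goldenRatio_pos (mu i)]

/-! ### The terms of a row and their limits -/

/-- The factor `f(x) / |sin (π x)|^σ` of the Fibonacci sum, as a function on `ℝ / ℤ`. -/
noncomputable def sinWeight (σ : ℝ) (f : ℝ → ℝ) (x : ℝ) : ℝ := f x / |sin (π * x)| ^ σ

theorem sinWeight_add_int (σ : ℝ) {f : ℝ → ℝ} (hper : Function.Periodic f 1) (x : ℝ) (z : ℤ) :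
    sinWeight σ f (x + z) = sinWeight σ f x := by
  have h1 : f (x + z) = f x := by simpa using hper.int_mul z x
  have h2 : |sin (π * (x + z))| = |sin (π * x)| := by
    rw [mul_add, mul_comm π (z : ℝ), sin_add_int_mul_pi, abs_mul, abs_zpow, abs_neg, abs_one,
      one_zpow, one_mul]
  rw [sinWeight, sinWeight, h1, h2]

theorem sinWeight_neg (σ : ℝ) {f : ℝ → ℝ} (hper : Function.Periodic f 1)
    (hsymm : ∀ t : ℝ, f t = f (1 - t)) (x : ℝ) : sinWeight σ f (-x) = sinWeight σ f x := by
  have h1 : f (-x) = f x := by rw [hsymm x, ← hper (-x)]; ring_nf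
  rw [sinWeight, sinWeight, h1, mul_neg, sin_neg, abs_neg]

theorem sinWeight_eq (σ : ℝ) (f : ℝ → ℝ) {x : ℝ} (h0 : 0 < x) (h1 : x < 1) :
    sinWeight σ f x = regPart σ f x * (π * x) ^ (-σ) := by
  have hs : 0 < sin (π * x) :=
    sin_pos_of_pos_of_lt_pi (mul_pos pi_pos h0) (by nlinarith [pi_pos])
  rw [sinWeight, abs_of_pos hs, div_sin_rpow_eq σ f h0 h1]

/-- The summand of the Fibonacci sum, including the normalization. -/
noncomputable def fibTerm (σ : ℝ) (f : ℝ → ℝ) (n : ℕ) (m : ℤ) : ℝ :=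
  1 / (Nat.fib n : ℝ) ^ σ * (sinWeight σ f ((m : ℝ) / Nat.fib n)
    * sinWeight σ f ((Nat.fib (n - 1) : ℝ) * m / Nat.fib n))

theorem fibSum_eq_sum_fibTerm (σ : ℝ) (f : ℝ → ℝ) (n : ℕ) :
    fibSum σ f n = ∑ m ∈ Finset.Ico 1 (Nat.fib n), fibTerm σ f n m := by
  rw [fibSum, Finset.mul_sum]
  refine Finset.sum_congr rfl fun m _ => ?_
  simp only [fibTerm, sinWeight, Int.cast_natCast, mul_div_assoc, mul_assoc]

/-- The size `5^{σ/2} / (π^{2σ} η_i^σ)` of the terms belonging to row `i`. -/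
noncomputable def rowScale (σ : ℝ) (i : ℕ) : ℝ := (π ^ 2 * eta i / √5) ^ (-σ)

theorem rowScale_eq (σ : ℝ) {i : ℕ} (hi : 1 ≤ i) :
    rowScale σ i = (5 : ℝ) ^ (σ / 2) / π ^ (2 * σ) * (1 / eta i ^ σ) := by
  have he := eta_pos hi
  have h5 : (√5 : ℝ) ^ (-σ) = ((5 : ℝ) ^ (σ / 2))⁻¹ := by
    rw [sqrt_eq_rpow, ← rpow_mul (by norm_num), ← rpow_neg (by norm_num)]
    congr 1; ring
  have hp : (π ^ 2) ^ (-σ) = (π ^ (2 * σ))⁻¹ := by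
    rw [← rpow_natCast, ← rpow_mul pi_pos.le, ← rpow_neg pi_pos.le]
    congr 1; push_cast; ring
  rw [rowScale, div_rpow (by positivity) (by positivity), mul_rpow (by positivity) he.le, h5, hp,
    rpow_neg he.le, div_eq_mul_inv, inv_inv]
  ring

theorem rowScale_pos (σ : ℝ) {i : ℕ} (hi : 1 ≤ i) : 0 < rowScale σ i := by
  have := eta_pos hi
  have := pi_pos
  exact rpow_pos_of_pos (by positivity) _

theorem rowLimit_eq (σ : ℝ) (f : ℝ → ℝ) {i : ℕ} (hi : 1 ≤ i) :
    rowLimit σ f i = rowScale σ i * f 0 ^ 2 := by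
  rw [rowLimit, rowScale_eq σ hi]
  field_simp

/-- The relative size `(ψ / φ)^k w₊*(i) / w₊(i)` of the second summand in Binet's formula for
`W_{i,k}`. -/
noncomputable def rowErr (i k : ℕ) : ℝ := wPlusStar i / wPlus i * (ψ / φ) ^ k

/-- The relative size `(ψ / φ)^m w₊(i) / w₊*(i)` of the second summand in Binet's formula for
`W*_{i,m}`. -/
noncomputable def dualErr (i m : ℕ) : ℝ := wPlus i / wPlusStar i * (ψ / φ) ^ m

theorem wythoff_eq_mul {i : ℕ} (hi : 1 ≤ i) (k : ℕ) :
    (wythoff i (k + 1) : ℝ) = wPlus i * φ ^ (k + 1) * (1 + rowErr i (k + 1)) / √5 := by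
  have hw : wPlus i ≠ 0 := by linarith [one_le_wPlus hi]
  have hp : φ ^ (k + 1) ≠ 0 := pow_ne_zero _ goldenRatio_ne_zero
  rw [eq_div_iff (by positivity), mul_comm, sqrt_five_mul_wythoff, rowErr, div_pow ψ φ]
  generalize φ ^ (k + 1) = P at *
  field_simp

theorem wythoffDual_eq_mul {i : ℕ} (hi : 1 ≤ i) (m : ℕ) :
    (wythoffDual i m : ℝ) = wPlusStar i * φ ^ m * (1 + dualErr i m) / √5 := by
  have hw : wPlusStar i ≠ 0 := (wPlusStar_pos hi).ne'
  have hp : φ ^ m ≠ 0 := pow_ne_zero _ goldenRatio_ne_zero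
  rw [eq_div_iff (by positivity), mul_comm, sqrt_five_mul_wythoffDual, dualErr, div_pow ψ φ]
  generalize φ ^ m = P at *
  field_simp

theorem fib_eq_mul (n : ℕ) : (Nat.fib n : ℝ) = φ ^ n * (1 - (ψ / φ) ^ n) / √5 := by
  have hp : φ ^ n ≠ 0 := pow_ne_zero _ goldenRatio_ne_zero
  rw [coe_fib_eq, div_pow ψ φ]
  generalize φ ^ n = P at *
  field_simp

theorem abs_goldenConj_div : |ψ / φ| = φ⁻¹ ^ 2 := by
  rw [abs_div, abs_of_neg goldenConj_neg, abs_of_pos goldenRatio_pos, ← inv_goldenRatio]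
  ring

theorem abs_goldenConj_div_pow (n : ℕ) : |(ψ / φ) ^ n| = φ⁻¹ ^ n * φ⁻¹ ^ n := by
  rw [abs_pow, abs_goldenConj_div]; ring

theorem inv_goldenRatio_bounds : 0 < φ⁻¹ ∧ φ⁻¹ < 5 / 8 := by
  rw [inv_goldenRatio_eq]
  constructor <;> linarith [goldenRatio_gt, goldenRatio_lt]

theorem inv_goldenRatio_pow_le {a b : ℕ} (h : a ≤ b) : φ⁻¹ ^ b ≤ φ⁻¹ ^ a :=
  pow_le_pow_of_le_one inv_goldenRatio_bounds.1.le (by linarith [inv_goldenRatio_bounds.2]) h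

theorem inv_goldenRatio_pow_bounds (n : ℕ) : 0 < φ⁻¹ ^ n ∧ φ⁻¹ ^ n ≤ 1 :=
  ⟨pow_pos inv_goldenRatio_bounds.1 n, by simpa using inv_goldenRatio_pow_le (Nat.zero_le n)⟩

theorem wPlus_div_le {i : ℕ} (hi : 1 ≤ i) (j : ℕ) :
    wPlus i / φ ^ (mu i + j) ≤ 13 / 16 * φ⁻¹ ^ j := by
  have hp : 0 < φ ^ mu i := pow_pos goldenRatio_pos _
  have hq : 0 < φ ^ j := pow_pos goldenRatio_pos _
  rw [div_le_iff₀ (pow_pos goldenRatio_pos _), pow_add, inv_pow]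
  have h := wPlus_le hi
  rw [pow_succ] at h
  have e : 13 / 16 * (φ ^ j)⁻¹ * (φ ^ mu i * φ ^ j) = 13 / 16 * φ ^ mu i := by field_simp
  rw [e]
  nlinarith [goldenRatio_lt]

theorem wPlus_div_pos {i : ℕ} (hi : 1 ≤ i) (m : ℕ) : 0 < wPlus i / φ ^ m :=
  div_pos (by linarith [one_le_wPlus hi]) (pow_pos goldenRatio_pos _)

theorem wPlus_div_le_three_quarters {i : ℕ} (hi : 1 ≤ i) (j : ℕ) :
    wPlus i / φ ^ (mu i + (j + 1)) ≤ 3 / 4 := by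
  have h := wPlus_div_le hi (j + 1)
  have h1 := inv_goldenRatio_bounds.2
  have h2 := inv_goldenRatio_pow_le (show 1 ≤ j + 1 by omega)
  rw [pow_one] at h2
  linarith

theorem wPlusStar_div_pos {i : ℕ} (hi : 1 ≤ i) (k : ℕ) : 0 < wPlusStar i / φ ^ k :=
  div_pos (wPlusStar_pos hi) (pow_pos goldenRatio_pos _)

theorem wPlusStar_div_le {i : ℕ} (hi : 1 ≤ i) (k : ℕ) : wPlusStar i / φ ^ k ≤ φ⁻¹ ^ k := by
  rw [inv_pow, div_eq_mul_inv]
  exact mul_le_of_le_one_left (inv_nonneg.2 (pow_pos goldenRatio_pos _).le)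
    (wPlusStar_lt_one hi).le

theorem wPlusStar_div_le_five_eighths {i : ℕ} (hi : 1 ≤ i) (k : ℕ) :
    wPlusStar i / φ ^ (k + 1) ≤ 5 / 8 := by
  have h := wPlusStar_div_le hi (k + 1)
  have h1 := inv_goldenRatio_bounds.2
  have h2 := inv_goldenRatio_pow_le (show 1 ≤ k + 1 by omega)
  rw [pow_one] at h2
  linarith

theorem abs_rowErr_le {i : ℕ} (hi : 1 ≤ i) (k : ℕ) : |rowErr i k| ≤ φ⁻¹ ^ k * φ⁻¹ ^ k := by
  have h1 := one_le_wPlus hi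
  have h2 := wPlusStar_lt_one hi
  have h3 := wPlusStar_pos hi
  rw [rowErr, abs_mul, abs_goldenConj_div_pow, abs_of_pos (by positivity)]
  refine mul_le_of_le_one_left (mul_self_nonneg _) ?_
  rw [div_le_one (by linarith)]
  linarith

theorem abs_rowErr_le_half {i : ℕ} (hi : 1 ≤ i) (k : ℕ) : |rowErr i (k + 1)| ≤ 1 / 2 := by
  have h := abs_rowErr_le hi (k + 1)
  obtain ⟨h0, h1⟩ := inv_goldenRatio_bounds
  have h2 := inv_goldenRatio_pow_le (show 1 ≤ k + 1 by omega)
  have h3 := inv_goldenRatio_pow_bounds (k + 1)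
  rw [pow_one] at h2
  nlinarith

theorem abs_dualErr_eq {i : ℕ} (hi : 1 ≤ i) (m : ℕ) :
    |dualErr i m| = wPlus i / φ ^ m * φ⁻¹ ^ m / wPlusStar i := by
  have h1 := one_le_wPlus hi
  have h3 := wPlusStar_pos hi
  rw [dualErr, abs_mul, abs_goldenConj_div_pow, abs_of_pos (by positivity), inv_pow]
  ring

theorem abs_dualErr_le {i : ℕ} (hi : 1 ≤ i) (j : ℕ) :
    |dualErr i (mu i + (j + 1))| ≤ 3 / 5 * φ⁻¹ ^ (j + 1) := by
  have h3 := wPlusStar_pos hi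
  have h4 := wPlusStar_gt hi
  have h5 := goldenRatio_lt
  obtain ⟨h0, h1⟩ := inv_goldenRatio_bounds
  have h6 := wPlus_div_le hi (j + 1)
  have h7 := wPlus_div_pos hi (mu i + (j + 1))
  have h8 : φ⁻¹ ^ (mu i + (j + 1)) ≤ 125 / 512 := by
    refine (inv_goldenRatio_pow_le (show 3 ≤ mu i + (j + 1) by have := two_le_mu hi; omega)).trans ?_
    refine (pow_le_pow_left₀ h0.le h1.le 3).trans ?_
    norm_num
  have h9 := (inv_goldenRatio_pow_bounds (mu i + (j + 1))).1
  rw [abs_dualErr_eq hi, div_le_iff₀ h3]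
  have h10 := mul_le_mul h6 h8 h9.le (by linarith)
  have h11 := (inv_goldenRatio_pow_bounds (j + 1)).1
  nlinarith

theorem abs_dualErr_le_half {i : ℕ} (hi : 1 ≤ i) (j : ℕ) :
    |dualErr i (mu i + (j + 1))| ≤ 1 / 2 := by
  have h := abs_dualErr_le hi j
  obtain ⟨h0, h1⟩ := inv_goldenRatio_bounds
  have h2 := inv_goldenRatio_pow_le (show 1 ≤ j + 1 by omega)
  rw [pow_one] at h2
  linarith

theorem abs_fibErr_le (n : ℕ) : |(ψ / φ) ^ n| ≤ φ⁻¹ ^ n := by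
  have h3 := inv_goldenRatio_pow_bounds n
  rw [abs_goldenConj_div_pow]
  nlinarith

theorem abs_fibErr_le_small {n : ℕ} (hn : 4 ≤ n) : |(ψ / φ) ^ n| ≤ 1 / 40 := by
  rw [abs_goldenConj_div_pow]
  have h2 := inv_goldenRatio_pow_le hn
  have h0 := (inv_goldenRatio_pow_bounds n).1
  have h4 := pow_le_pow_left₀ inv_goldenRatio_bounds.1.le inv_goldenRatio_bounds.2.le 4
  nlinarith

theorem wythoff_div_fib {i : ℕ} (hi : 1 ≤ i) (k m : ℕ) :
    (wythoff i (k + 1) : ℝ) / Nat.fib (k + 1 + m)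
      = wPlus i / φ ^ m * (1 + rowErr i (k + 1)) / (1 - (ψ / φ) ^ (k + 1 + m)) := by
  have hp : φ ^ (k + 1) ≠ 0 := pow_ne_zero _ goldenRatio_ne_zero
  have hq : φ ^ m ≠ 0 := pow_ne_zero _ goldenRatio_ne_zero
  have h5 : √5 ≠ 0 := by positivity
  rw [wythoff_eq_mul hi, fib_eq_mul, pow_add φ (k + 1) m, div_div_div_cancel_right₀ h5]
  generalize φ ^ (k + 1) = P at *
  generalize φ ^ m = Q at *
  generalize (ψ / φ) ^ (k + 1 + m) = e
  field_simp

theorem wythoffDual_div_fib {i : ℕ} (hi : 1 ≤ i) (k m : ℕ) :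
    (wythoffDual i m : ℝ) / Nat.fib (k + m)
      = wPlusStar i / φ ^ k * (1 + dualErr i m) / (1 - (ψ / φ) ^ (k + m)) := by
  have hp : φ ^ k ≠ 0 := pow_ne_zero _ goldenRatio_ne_zero
  have hq : φ ^ m ≠ 0 := pow_ne_zero _ goldenRatio_ne_zero
  have h5 : √5 ≠ 0 := by positivity
  rw [wythoffDual_eq_mul hi, fib_eq_mul, pow_add φ k m, div_div_div_cancel_right₀ h5]
  generalize φ ^ k = P at *
  generalize φ ^ m = Q at *
  generalize (ψ / φ) ^ (k + m) = e
  field_simp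

theorem abs_mul_one_add_div_one_sub_sub_le {A u e τ : ℝ} (hA0 : 0 ≤ A) (hA1 : A ≤ 1)
    (he : |e| ≤ 1 / 40) (heτ : |e| ≤ τ) (huτ : A * |u| ≤ τ) :
    |A * (1 + u) / (1 - e) - A| ≤ 4 * τ := by
  have h1 : 39 / 40 ≤ 1 - e := by linarith [(abs_le.1 he).2]
  have e1 : A * (1 + u) / (1 - e) - A = (A * u + A * e) / (1 - e) := by
    field_simp; ring
  have h2 : |A * u + A * e| ≤ 2 * τ := by
    refine (abs_add_le _ _).trans ?_
    rw [abs_mul, abs_mul, abs_of_nonneg hA0]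
    nlinarith [abs_nonneg e]
  rw [e1, abs_div, abs_of_pos (by linarith : 0 < 1 - e), div_le_iff₀ (by linarith)]
  nlinarith [abs_nonneg e]

/-- Multiplication by `F_{n-1}` modulo `F_n` exchanges, up to sign, the Wythoff array and its
dual. -/
theorem fib_mul_wythoff_div (i k m : ℕ) :
    (Nat.fib (k + 1 + m - 1) : ℝ) * wythoff i (k + 1) / Nat.fib (k + 1 + m)
      = (-1) ^ (k + 1) * (wythoffDual i m / Nat.fib (k + 1 + m)) + wythoff i k := by
  have h := congrArg (fun z : ℤ => (z : ℝ)) (wythoffDual_eq i m k)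
  have hF : (Nat.fib (k + 1 + m) : ℝ) ≠ 0 := by
    exact_mod_cast (Nat.fib_pos.2 (by omega)).ne'
  push_cast at h
  rw [show m + k + 1 = k + 1 + m by ring] at h
  rw [show k + 1 + m - 1 = m + k by omega, h]
  have h1 : ((-1 : ℝ) ^ (k + 1)) * (-1) ^ (k + 1) = 1 := by
    rw [← mul_pow]; norm_num
  field_simp
  linear_combination ((Nat.fib (k + 1 + m) : ℝ) * wythoff i k
    - (Nat.fib (m + k) : ℝ) * wythoff i (k + 1)) * h1

theorem sinWeight_fib_mul_wythoff (σ : ℝ) {f : ℝ → ℝ} (hper : Function.Periodic f 1)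
    (hsymm : ∀ t : ℝ, f t = f (1 - t)) (i k m : ℕ) :
    sinWeight σ f ((Nat.fib (k + 1 + m - 1) : ℝ) * wythoff i (k + 1) / Nat.fib (k + 1 + m))
      = sinWeight σ f ((wythoffDual i m : ℝ) / Nat.fib (k + 1 + m)) := by
  rw [fib_mul_wythoff_div, sinWeight_add_int σ hper]
  rcases neg_one_pow_eq_or ℝ (k + 1) with h | h
  · rw [h, one_mul]
  · rw [h, neg_one_mul, sinWeight_neg σ hper hsymm]

theorem rpow_scale_eq {σ P Q c : ℝ} (hP : 0 < P) (hQ : 0 < Q) (hc : P * Q = c) :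
    P ^ (-σ) * Q ^ (-σ) = c ^ (-σ) := by
  rw [← mul_rpow hP.le hQ.le, hc]

theorem one_add_rowErr_pos {i : ℕ} (hi : 1 ≤ i) (k : ℕ) : 0 < 1 + rowErr i (k + 1) := by
  linarith [(abs_le.1 (abs_rowErr_le_half hi k)).1]

theorem one_add_dualErr_pos {i : ℕ} (hi : 1 ≤ i) (j : ℕ) :
    0 < 1 + dualErr i (mu i + (j + 1)) := by
  linarith [(abs_le.1 (abs_dualErr_le_half hi j)).1]

theorem wythoffDual_pos {i : ℕ} (hi : 1 ≤ i) (j : ℕ) :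
    (0 : ℝ) < wythoffDual i (mu i + (j + 1)) := by
  rw [wythoffDual_eq_mul hi]
  have := wPlusStar_pos hi
  have := one_add_dualErr_pos hi j
  have := pow_pos goldenRatio_pos (mu i + (j + 1))
  positivity

theorem deltaTerm_eq (σ : ℝ) (f : ℝ → ℝ) {i : ℕ} (hi : 1 ≤ i) (k : ℕ) :
    deltaTerm σ f i (k + 1) = rowScale σ i
      * ((1 + rowErr i (k + 1)) ^ (-σ) * regPart σ f (wPlusStar i / φ ^ (k + 1)) * f 0
        - f 0 ^ 2) := by
  have hπ := pi_pos
  have hη := eta_pos hi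
  have hW : (0 : ℝ) < wythoff i (k + 1) := by exact_mod_cast wythoff_pos hi k
  have hw : wPlus i ≠ 0 := by linarith [one_le_wPlus hi]
  have hB := wPlusStar_div_pos hi (k + 1)
  have hc : (π * wythoff i (k + 1)) * (π * (wPlusStar i / φ ^ (k + 1)))
      = (π ^ 2 * eta i / √5) * (1 + rowErr i (k + 1)) := by
    have hp : φ ^ (k + 1) ≠ 0 := pow_ne_zero _ goldenRatio_ne_zero
    rw [wythoff_eq_mul hi, eta_eq]
    generalize φ ^ (k + 1) = P at *
    field_simp
  have h1 := rpow_scale_eq (σ := σ) (mul_pos hπ hW) (mul_pos hπ hB) hc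
  rw [mul_rpow (by positivity) (one_add_rowErr_pos hi k).le, ← rowScale] at h1
  rw [deltaTerm, ← wPlusStar,
    div_sin_rpow_eq σ f hB (by linarith [wPlusStar_div_le_five_eighths hi k]),
    ← mul_rpow hπ.le hW.le, div_eq_mul_inv (f 0), ← rpow_neg (mul_pos hπ hW).le,
    rowLimit_eq σ f hi]
  linear_combination f 0 * regPart σ f (wPlusStar i / φ ^ (k + 1)) * h1

theorem deltaDualTerm_eq (σ : ℝ) (f : ℝ → ℝ) {i : ℕ} (hi : 1 ≤ i) (j : ℕ) :
    deltaDualTerm σ f i (j + 1) = rowScale σ i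
      * ((1 + dualErr i (mu i + (j + 1))) ^ (-σ)
        * regPart σ f (wPlus i / φ ^ (mu i + (j + 1))) * f 0 - f 0 ^ 2) := by
  have hπ := pi_pos
  have hη := eta_pos hi
  have hW := wythoffDual_pos hi j
  have hw := wPlusStar_pos hi
  have hB := wPlus_div_pos hi (mu i + (j + 1))
  have hc : (π * wythoffDual i (mu i + (j + 1))) * (π * (wPlus i / φ ^ (mu i + (j + 1))))
      = (π ^ 2 * eta i / √5) * (1 + dualErr i (mu i + (j + 1))) := by
    have hp : φ ^ (mu i + (j + 1)) ≠ 0 := pow_ne_zero _ goldenRatio_ne_zero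
    rw [wythoffDual_eq_mul hi, eta_eq]
    generalize φ ^ (mu i + (j + 1)) = P at *
    field_simp
  have h1 := rpow_scale_eq (σ := σ) (mul_pos hπ hW) (mul_pos hπ hB) hc
  rw [mul_rpow (by positivity) (one_add_dualErr_pos hi j).le, ← rowScale] at h1
  rw [deltaDualTerm, div_sin_rpow_eq σ f hB (by linarith [wPlus_div_le_three_quarters hi j]),
    ← mul_rpow hπ.le hW.le, div_eq_mul_inv (f 0), ← rpow_neg (mul_pos hπ hW).le,
    rowLimit_eq σ f hi]
  linear_combination f 0 * regPart σ f (wPlus i / φ ^ (mu i + (j + 1))) * h1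

theorem inv_goldenRatio_pow_four_le {n : ℕ} (hn : 4 ≤ n) : φ⁻¹ ^ n ≤ 625 / 4096 := by
  refine (inv_goldenRatio_pow_le hn).trans ?_
  refine (pow_le_pow_left₀ inv_goldenRatio_bounds.1.le inv_goldenRatio_bounds.2.le 4).trans ?_
  norm_num

/-- The argument `W_{i,k} / F_n` lies in `(0, 3/4]`, at distance `O(φ⁻ⁿ)` from its limit. -/
theorem wythoff_div_fib_bounds {i : ℕ} (hi : 1 ≤ i) (k j : ℕ) {n : ℕ}
    (hn : n = k + 1 + (mu i + (j + 1))) :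
    0 < (wythoff i (k + 1) : ℝ) / Nat.fib n ∧ (wythoff i (k + 1) : ℝ) / Nat.fib n ≤ 3 / 4 ∧
      |(wythoff i (k + 1) : ℝ) / Nat.fib n - wPlus i / φ ^ (mu i + (j + 1))| ≤ 4 * φ⁻¹ ^ n := by
  have hF : (0 : ℝ) < Nat.fib n := by exact_mod_cast Nat.fib_pos.2 (by omega)
  have hW : (0 : ℝ) < wythoff i (k + 1) := by exact_mod_cast wythoff_pos hi k
  have hlt : 2 * wythoff i (k + 1) < (Nat.fib n : ℤ) := by
    rw [two_mul_wythoff_lt_fib_iff hi]; omega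
  have hlt' : 2 * (wythoff i (k + 1) : ℝ) < Nat.fib n := by exact_mod_cast hlt
  refine ⟨div_pos hW hF, by rw [div_le_iff₀ hF]; linarith, ?_⟩
  have hA := wPlus_div_pos hi (mu i + (j + 1))
  have hA' := wPlus_div_le_three_quarters hi j
  rw [hn, wythoff_div_fib hi k]
  refine abs_mul_one_add_div_one_sub_sub_le hA.le (by linarith)
    (abs_fibErr_le_small (by have := two_le_mu hi; omega)) (abs_fibErr_le _) ?_
  generalize mu i + (j + 1) = m at *
  have hw : 0 < wPlus i := by linarith [one_le_wPlus hi]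
  have hw' := wPlusStar_pos hi
  have h1 : wPlus i / φ ^ m * |rowErr i (k + 1)|
      = wPlusStar i * φ⁻¹ ^ (k + 1) * φ⁻¹ ^ (k + 1 + m) := by
    rw [rowErr, abs_mul, abs_goldenConj_div_pow, abs_of_pos (by positivity),
      pow_add φ⁻¹ (k + 1) m, inv_pow φ m]
    field_simp
  rw [h1]
  refine mul_le_of_le_one_left (inv_goldenRatio_pow_bounds _).1.le ?_
  have h2 := inv_goldenRatio_pow_bounds (k + 1)
  have h3 := wPlusStar_lt_one hi
  nlinarith

/-- The argument `W*_{i,m} / F_n` lies in `(0, 3/4]`, at distance `O(φ⁻ⁿ)` from its limit. -/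
theorem wythoffDual_div_fib_bounds {i : ℕ} (hi : 1 ≤ i) (k j : ℕ) {n : ℕ}
    (hn : n = k + 1 + (mu i + (j + 1))) :
    0 < (wythoffDual i (mu i + (j + 1)) : ℝ) / Nat.fib n ∧
      (wythoffDual i (mu i + (j + 1)) : ℝ) / Nat.fib n ≤ 3 / 4 ∧
      |(wythoffDual i (mu i + (j + 1)) : ℝ) / Nat.fib n - wPlusStar i / φ ^ (k + 1)|
        ≤ 4 * φ⁻¹ ^ n := by
  have hF : (0 : ℝ) < Nat.fib n := by exact_mod_cast Nat.fib_pos.2 (by omega)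
  refine ⟨div_pos (wythoffDual_pos hi j) hF, ?_⟩
  have hB := wPlusStar_div_pos hi (k + 1)
  have hB' := wPlusStar_div_le_five_eighths hi k
  have hA := wPlus_div_pos hi (mu i + (j + 1))
  have h4n : 4 ≤ n := by have := two_le_mu hi; omega
  have hA' : wPlus i / φ ^ (mu i + (j + 1)) ≤ 1 / 2 * (21 / 20) := by
    have h5 := wPlus_div_le hi (j + 1)
    have h6 := inv_goldenRatio_pow_le (show 1 ≤ j + 1 by omega)
    rw [pow_one] at h6
    linarith [inv_goldenRatio_bounds.2]
  have he40 := abs_fibErr_le_small h4n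
  have he := abs_fibErr_le n
  have hτ := (inv_goldenRatio_pow_bounds n).1
  have hn4 := inv_goldenRatio_pow_four_le h4n
  have hv : wPlusStar i / φ ^ (k + 1) * |dualErr i (mu i + (j + 1))|
      ≤ 1 / 2 * (21 / 20) * φ⁻¹ ^ n := by
    have hw' := wPlusStar_pos hi
    have h4 : wPlusStar i / φ ^ (k + 1) * |dualErr i (mu i + (j + 1))|
        = wPlus i / φ ^ (mu i + (j + 1)) * φ⁻¹ ^ n := by
      rw [abs_dualErr_eq hi, hn, pow_add φ⁻¹ (k + 1) (mu i + (j + 1)), inv_pow φ (k + 1)]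
      generalize mu i + (j + 1) = m at *
      field_simp
    rw [h4]
    exact mul_le_mul_of_nonneg_right hA' hτ.le
  have hy := wythoffDual_div_fib hi (k + 1) (mu i + (j + 1))
  rw [← hn] at hy
  rw [hy]
  constructor
  · have h1 := mul_le_mul_of_nonneg_left (le_abs_self (dualErr i (mu i + (j + 1)))) hB.le
    have h2 := (abs_le.1 he40).2
    rw [div_le_iff₀ (by linarith)]
    linarith
  · exact abs_mul_one_add_div_one_sub_sub_le hB.le (by linarith) he40 he (by linarith)

theorem fibTerm_wythoff_eq (σ : ℝ) {f : ℝ → ℝ} (hper : Function.Periodic f 1)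
    (hsymm : ∀ t : ℝ, f t = f (1 - t)) {i : ℕ} (hi : 1 ≤ i) (k j : ℕ) {n : ℕ}
    (hn : n = k + 1 + (mu i + (j + 1))) :
    fibTerm σ f n (wythoff i (k + 1)) = rowScale σ i * ((1 - (ψ / φ) ^ n) ^ σ
        * (1 + rowErr i (k + 1)) ^ (-σ) * (1 + dualErr i (mu i + (j + 1))) ^ (-σ)
        * (regPart σ f ((wythoff i (k + 1) : ℝ) / Nat.fib n)
          * regPart σ f ((wythoffDual i (mu i + (j + 1)) : ℝ) / Nat.fib n))) := by
  have hF : (0 : ℝ) < Nat.fib n := by exact_mod_cast Nat.fib_pos.2 (by omega)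
  obtain ⟨hx0, hx1, -⟩ := wythoff_div_fib_bounds hi k j hn
  obtain ⟨hy0, hy1, -⟩ := wythoffDual_div_fib_bounds hi k j hn
  have h1 := sinWeight_fib_mul_wythoff σ hper hsymm i k (mu i + (j + 1))
  have hy := wythoffDual_div_fib hi (k + 1) (mu i + (j + 1))
  have he1 : 0 < 1 - (ψ / φ) ^ n := by
    linarith [(abs_le.1 (abs_fibErr_le_small (n := n) (by have := two_le_mu hi; omega))).2]
  have hu := one_add_rowErr_pos hi k
  have hv := one_add_dualErr_pos hi j
  rw [← hn] at h1 hy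
  rw [fibTerm, h1, sinWeight_eq σ f hx0 (by linarith), sinWeight_eq σ f hy0 (by linarith),
    one_div, ← rpow_neg hF.le]
  have h3 : (Nat.fib n : ℝ) * (wythoff i (k + 1) / Nat.fib n) = wythoff i (k + 1) := by
    field_simp
  clear h1 hx1 hy1 hn
  generalize mu i + (j + 1) = m at *
  generalize (ψ / φ) ^ n = e at *
  generalize (wythoff i (k + 1) : ℝ) / Nat.fib n = x at *
  generalize (wythoffDual i m : ℝ) / Nat.fib n = y at *
  have hπ := pi_pos
  have hη := eta_pos hi
  have h2 : (Nat.fib n : ℝ) * ((π * x) * (π * y)) * (1 - e)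
      = (π ^ 2 * eta i / √5) * ((1 + rowErr i (k + 1)) * (1 + dualErr i m)) := by
    have h4 : y * (1 - e) = wPlusStar i / φ ^ (k + 1) * (1 + dualErr i m) := by
      rw [hy]; exact div_mul_cancel₀ _ he1.ne'
    have h5 : (Nat.fib n : ℝ) * ((π * x) * (π * y)) * (1 - e)
        = π ^ 2 * (Nat.fib n * x) * (y * (1 - e)) := by ring
    have hp : φ ^ (k + 1) ≠ 0 := pow_ne_zero _ goldenRatio_ne_zero
    rw [h5, h3, h4, wythoff_eq_mul hi, eta_eq]
    generalize φ ^ (k + 1) = P at *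
    field_simp
  have h6 : ((Nat.fib n : ℝ) * ((π * x) * (π * y)) * (1 - e)) ^ (-σ)
      = ((π ^ 2 * eta i / √5) * ((1 + rowErr i (k + 1)) * (1 + dualErr i m))) ^ (-σ) := by
    rw [h2]
  have hπx := mul_pos hπ hx0
  have hπy := mul_pos hπ hy0
  rw [mul_rpow (by positivity) he1.le, mul_rpow hF.le (by positivity),
    mul_rpow hπx.le hπy.le, mul_rpow (by positivity) (mul_pos hu hv).le,
    mul_rpow hu.le hv.le, ← rowScale] at h6
  have h7 : (1 - e) ^ σ * (1 - e) ^ (-σ) = 1 := by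
    rw [← rpow_add he1, add_neg_cancel, rpow_zero]
  linear_combination (1 - e) ^ σ * regPart σ f x * regPart σ f y * h6
    - (Nat.fib n : ℝ) ^ (-σ) * (π * x) ^ (-σ) * (π * y) ^ (-σ) * regPart σ f x
      * regPart σ f y * h7

/-- The comparison of the terms of row `i` with their limits as the column `k` or the dual column
`j` is fixed, uniform in `i`. The last bound decays in `k + j = n - μ_i`. -/
theorem exists_row_bounds (σ : ℝ) {α : ℝ} (hα0 : 0 < α) (hα1 : α ≤ 1) {f : ℝ → ℝ}
    (hper : Function.Periodic f 1) (hsymm : ∀ t : ℝ, f t = f (1 - t))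
    {L : ℝ} (hL : 0 ≤ L)
    (hf : ∀ x ∈ Set.Ico (0 : ℝ) 1, ∀ y ∈ Set.Ico (0 : ℝ) 1, |f x - f y| ≤ L * |x - y| ^ α) :
    ∃ C : ℝ, 0 ≤ C ∧ ∀ i : ℕ, 1 ≤ i →
      (∀ k : ℕ, |deltaTerm σ f i (k + 1)| ≤ C * rowScale σ i * (φ⁻¹ ^ α) ^ (k + 1)) ∧
      (∀ j : ℕ, |deltaDualTerm σ f i (j + 1)| ≤ C * rowScale σ i * (φ⁻¹ ^ α) ^ (j + 1)) ∧
      (∀ k j : ℕ, |fibTerm σ f (k + 1 + (mu i + (j + 1))) (wythoff i (k + 1)) - rowLimit σ f i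
          - deltaTerm σ f i (k + 1) - deltaDualTerm σ f i (j + 1)|
        ≤ C * rowScale σ i * (φ⁻¹ ^ α) ^ (k + 1 + (j + 1))) := by
  obtain ⟨C, hC, hsingle, hmixed⟩ := exists_mixed_difference_bound σ hα0 hα1 hL hf
  obtain ⟨t0, t1⟩ := inv_goldenRatio_bounds
  have hρ : ∀ n : ℕ, (φ⁻¹ ^ α) ^ n = (φ⁻¹ ^ n) ^ α := fun n => by
    rw [← rpow_natCast, ← rpow_mul t0.le, mul_comm, rpow_mul t0.le, rpow_natCast]
  have hle : ∀ n : ℕ, φ⁻¹ ^ n ≤ (φ⁻¹ ^ α) ^ n := fun n => by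
    rw [hρ]
    exact self_le_rpow_of_le_one (inv_goldenRatio_pow_bounds n).1.le
      (inv_goldenRatio_pow_bounds n).2 hα1
  have hρ0 : 0 < φ⁻¹ ^ α := rpow_pos_of_pos t0 _
  refine ⟨5 * C, by positivity, fun i hi => ?_⟩
  have hs := rowScale_pos σ hi
  have hA : ∀ j, wPlus i / φ ^ (mu i + (j + 1)) ∈ Set.Icc (0 : ℝ) (3 / 4) := fun j =>
    ⟨(wPlus_div_pos hi _).le, wPlus_div_le_three_quarters hi j⟩
  have hB : ∀ k, wPlusStar i / φ ^ (k + 1) ∈ Set.Icc (0 : ℝ) (3 / 4) := fun k =>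
    ⟨(wPlusStar_div_pos hi _).le, (wPlusStar_div_le_five_eighths hi k).trans (by norm_num)⟩
  have hAp : ∀ j, (wPlus i / φ ^ (mu i + (j + 1))) ^ α ≤ (φ⁻¹ ^ α) ^ (j + 1) := fun j => by
    rw [hρ]
    refine rpow_le_rpow (hA j).1 ((wPlus_div_le hi (j + 1)).trans ?_) hα0.le
    linarith [(inv_goldenRatio_pow_bounds (j + 1)).1]
  have hBq : ∀ k, (wPlusStar i / φ ^ (k + 1)) ^ α ≤ (φ⁻¹ ^ α) ^ (k + 1) := fun k => by
    rw [hρ]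
    exact rpow_le_rpow (hB k).1 (wPlusStar_div_le hi (k + 1)) hα0.le
  have hvp : ∀ j, |dualErr i (mu i + (j + 1))| ≤ (φ⁻¹ ^ α) ^ (j + 1) := fun j =>
    (abs_dualErr_le hi j).trans (le_trans (by linarith [(inv_goldenRatio_pow_bounds (j + 1)).1])
      (hle (j + 1)))
  have huq : ∀ k, |rowErr i (k + 1)| ≤ (φ⁻¹ ^ α) ^ (k + 1) := fun k =>
    (abs_rowErr_le hi (k + 1)).trans (le_trans (by
      nlinarith [(inv_goldenRatio_pow_bounds (k + 1)).1, (inv_goldenRatio_pow_bounds (k + 1)).2])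
      (hle (k + 1)))
  refine ⟨fun k => ?_, fun j => ?_, fun k j => ?_⟩
  · rw [deltaTerm_eq σ f hi, abs_mul, abs_of_pos hs]
    have h := hsingle _ (hB k) _ _ (abs_rowErr_le_half hi k) (hBq k) (huq k)
    have h0 := (abs_nonneg _).trans h
    nlinarith
  · rw [deltaDualTerm_eq σ f hi, abs_mul, abs_of_pos hs]
    have h := hsingle _ (hA j) _ _ (abs_dualErr_le_half hi j) (hAp j) (hvp j)
    have h0 := (abs_nonneg _).trans h
    nlinarith
  · obtain ⟨n, hn⟩ : ∃ n, n = k + 1 + (mu i + (j + 1)) := ⟨_, rfl⟩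
    obtain ⟨hx0, hx1, hxA⟩ := wythoff_div_fib_bounds hi k j hn
    obtain ⟨hy0, hy1, hyB⟩ := wythoffDual_div_fib_bounds hi k j hn
    have hτ := inv_goldenRatio_pow_bounds n
    have he40 := abs_fibErr_le_small (n := n) (by have := two_le_mu hi; omega)
    rw [deltaDualTerm_eq σ f hi, deltaTerm_eq σ f hi, ← hn,
      fibTerm_wythoff_eq σ hper hsymm hi k j hn, rowLimit_eq σ f hi]
    have hr : ∀ d : ℝ, |d| ≤ 4 * φ⁻¹ ^ n → |d| ^ α ≤ 4 * (φ⁻¹ ^ α) ^ n := by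
      intro d hd
      refine (rpow_le_rpow (abs_nonneg _) hd hα0.le).trans ?_
      rw [mul_rpow (by norm_num) hτ.1.le, hρ]
      refine mul_le_mul_of_nonneg_right ?_ (rpow_nonneg hτ.1.le _)
      exact rpow_le_self_of_one_le (by norm_num) hα1
    have hρn : (φ⁻¹ ^ α) ^ n ≤ (φ⁻¹ ^ α) ^ (k + 1 + (j + 1)) :=
      pow_le_pow_of_le_one hρ0.le (rpow_le_one t0.le (by linarith) hα0.le) (by omega)
    have her : |(ψ / φ) ^ n| ≤ 4 * (φ⁻¹ ^ α) ^ n := by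
      have := hle n
      have := pow_pos hρ0 n
      linarith [abs_fibErr_le n]
    have hmix := hmixed _ (hA j) _ (hB k) _ ⟨hx0.le, hx1⟩ _ ⟨hy0.le, hy1⟩ _ _ _ _ _ _
      (abs_rowErr_le_half hi k) (abs_dualErr_le_half hi j) (he40.trans (by norm_num))
      (hAp j) (hvp j) (hBq k) (huq k) (hr _ hxA) (hr _ hyB) her
    have efin : ∀ T D1 D2 s c : ℝ, s * T - s * c - s * (D1 - c) - s * (D2 - c)
        = s * (T - D1 - D2 + c) := by intros; ring
    rw [efin, abs_mul, abs_of_pos hs]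
    refine (mul_le_mul_of_nonneg_left hmix hs.le).trans ?_
    have hpq : (φ⁻¹ ^ α) ^ (j + 1) * (φ⁻¹ ^ α) ^ (k + 1) = (φ⁻¹ ^ α) ^ (k + 1 + (j + 1)) := by
      rw [← pow_add]; congr 1; ring
    rw [hpq]
    have : C * ((φ⁻¹ ^ α) ^ (k + 1 + (j + 1)) + 4 * (φ⁻¹ ^ α) ^ n)
        ≤ C * (5 * (φ⁻¹ ^ α) ^ (k + 1 + (j + 1))) :=
      mul_le_mul_of_nonneg_left (by linarith) hC
    refine (mul_le_mul_of_nonneg_left this hs.le).trans (le_of_eq ?_)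
    ring

/-! ### Splitting the Fibonacci sum by rows -/

theorem fibTerm_reflect (σ : ℝ) {f : ℝ → ℝ} (hper : Function.Periodic f 1)
    (hsymm : ∀ t : ℝ, f t = f (1 - t)) {n : ℕ} (hn : 1 ≤ n) (m : ℤ) :
    fibTerm σ f n (Nat.fib n - m) = fibTerm σ f n m := by
  have hF : (Nat.fib n : ℝ) ≠ 0 := by exact_mod_cast (Nat.fib_pos.2 hn).ne'
  have e1 : (((Nat.fib n : ℤ) - m : ℤ) : ℝ) / Nat.fib n = -((m : ℝ) / Nat.fib n) + (1 : ℤ) := by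
    push_cast; field_simp; ring
  have e2 : (Nat.fib (n - 1) : ℝ) * (((Nat.fib n : ℤ) - m : ℤ) : ℝ) / Nat.fib n
      = -((Nat.fib (n - 1) : ℝ) * m / Nat.fib n) + (Nat.fib (n - 1) : ℤ) := by
    push_cast; field_simp; ring
  rw [fibTerm, e1, e2, sinWeight_add_int σ hper, sinWeight_add_int σ hper,
    sinWeight_neg σ hper hsymm, sinWeight_neg σ hper hsymm, fibTerm]

theorem sum_Ico_eq_two_mul_of_reflect {N : ℕ} {G : ℕ → ℝ}
    (hG : ∀ m ∈ Finset.Ico 1 N, G (N - m) = G m) :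
    ∑ m ∈ Finset.Ico 1 N, G m = 2 * ∑ m ∈ Finset.Ico 1 N with 2 * m < N, G m
      + ∑ m ∈ Finset.Ico 1 N with 2 * m = N, G m := by
  have h1 := Finset.sum_filter_add_sum_filter_not (Finset.Ico 1 N) (fun m => 2 * m < N) G
  have h2 := Finset.sum_filter_add_sum_filter_not
    ((Finset.Ico 1 N).filter (fun m => ¬ 2 * m < N)) (fun m => 2 * m = N) G
  rw [Finset.filter_filter, Finset.filter_filter] at h2
  have h3 : ∑ m ∈ Finset.Ico 1 N with ¬ 2 * m < N ∧ 2 * m = N, G m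
      = ∑ m ∈ Finset.Ico 1 N with 2 * m = N, G m := by
    refine Finset.sum_congr (Finset.filter_congr fun m _ => ?_) fun _ _ => rfl
    omega
  have h4 : ∑ m ∈ Finset.Ico 1 N with ¬ 2 * m < N ∧ ¬ 2 * m = N, G m
      = ∑ m ∈ Finset.Ico 1 N with 2 * m < N, G m := by
    refine Finset.sum_nbij' (fun m => N - m) (fun m => N - m) ?_ ?_ ?_ ?_ ?_
    · intro m hm
      simp only [Finset.mem_filter, Finset.mem_Ico] at hm ⊢
      omega
    · intro m hm
      simp only [Finset.mem_filter, Finset.mem_Ico] at hm ⊢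
      omega
    · intro m hm
      simp only [Finset.mem_filter, Finset.mem_Ico] at hm
      omega
    · intro m hm
      simp only [Finset.mem_filter, Finset.mem_Ico] at hm
      omega
    · intro m hm
      exact (hG m (Finset.mem_filter.1 hm).1).symm
  linarith

theorem lt_fib_of_mu_add_two_le {i n : ℕ} (hi : 1 ≤ i) (h : mu i + 2 ≤ n) : i < Nat.fib n := by
  have h1 := (two_mul_wythoff_lt_fib_iff hi 0 n).2 (by omega)
  have h2 := le_wythoff_one hi
  simp only [zero_add] at h1
  omega

/-- The integers in `[1, F_n / 2)` are sorted by the rows of the Wythoff array. -/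
theorem sum_lt_half_fib_eq (n : ℕ) (G : ℤ → ℝ) :
    ∑ m ∈ Finset.Ico 1 (Nat.fib n) with 2 * m < Nat.fib n, G m
      = ∑ i ∈ Finset.range (Nat.fib n), ∑ k ∈ Finset.range (n - mu (i + 1) - 1),
        G (wythoff (i + 1) (k + 1)) := by
  rw [Finset.sum_sigma']
  symm
  refine Finset.sum_bij (fun p _ => (wythoff (p.1 + 1) (p.2 + 1)).toNat) ?_ ?_ ?_ ?_
  · rintro ⟨i, k⟩ hp
    simp only [Finset.mem_sigma, Finset.mem_range] at hp
    have h1 := (two_mul_wythoff_lt_fib_iff (i := i + 1) (by omega) k n).2 (by omega)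
    have h2 := wythoff_pos (i := i + 1) (by omega) k
    simp only [Finset.mem_filter, Finset.mem_Ico]
    omega
  · rintro ⟨i, k⟩ hp ⟨i', k'⟩ hp' h
    have h2 := wythoff_pos (i := i + 1) (by omega) k
    have h3 := wythoff_pos (i := i' + 1) (by omega) k'
    dsimp only at h
    obtain ⟨e1, e2⟩ := wythoff_injective (i := i + 1) (i' := i' + 1) (by omega) (by omega) k k'
      (by omega)
    obtain rfl : i = i' := by omega
    subst e2
    rfl
  · intro m hm
    simp only [Finset.mem_filter, Finset.mem_Ico] at hm
    obtain ⟨i, k, hi, e⟩ := exists_wythoff_eq (m := m) (by omega)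
    have h1 := (two_mul_wythoff_lt_fib_iff hi k n).1 (by omega)
    have h2 := lt_fib_of_mu_add_two_le hi (show mu i + 2 ≤ n by omega)
    obtain ⟨i, rfl⟩ : ∃ i', i = i' + 1 := ⟨i - 1, by omega⟩
    refine ⟨⟨i, k⟩, ?_, ?_⟩
    · simp only [Finset.mem_sigma, Finset.mem_range]
      omega
    · simp only [← e, Int.toNat_natCast]
  · rintro ⟨i, k⟩ hp
    have h2 := wythoff_pos (i := i + 1) (by omega) k
    rw [Int.toNat_of_nonneg h2.le]

/-- The contribution of the midpoint `m = F_n / 2`, present when `F_n` is even. -/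
noncomputable def midTerm (σ : ℝ) (f : ℝ → ℝ) (n : ℕ) : ℝ :=
  ∑ m ∈ Finset.Ico 1 (Nat.fib n) with 2 * m = Nat.fib n, fibTerm σ f n m

theorem fibSum_eq_sum_rows (σ : ℝ) {f : ℝ → ℝ} (hper : Function.Periodic f 1)
    (hsymm : ∀ t : ℝ, f t = f (1 - t)) {n : ℕ} (hn : 1 ≤ n) :
    fibSum σ f n = 2 * ∑' i : ℕ, ∑ k ∈ Finset.range (n - mu (i + 1) - 1),
      fibTerm σ f n (wythoff (i + 1) (k + 1)) + midTerm σ f n := by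
  rw [fibSum_eq_sum_fibTerm, sum_Ico_eq_two_mul_of_reflect (G := fun m : ℕ => fibTerm σ f n m),
    sum_lt_half_fib_eq n (fibTerm σ f n), midTerm, tsum_eq_sum]
  · intro i hi
    have : n - mu (i + 1) - 1 = 0 := by
      by_contra h
      have := lt_fib_of_mu_add_two_le (i := i + 1) (n := n) (by omega) (by omega)
      rw [Finset.mem_range] at hi
      omega
    rw [this, Finset.range_zero, Finset.sum_empty]
  · intro m hm
    rw [Finset.mem_Ico] at hm
    rw [Nat.cast_sub hm.2.le]
    exact fibTerm_reflect σ hper hsymm hn m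

theorem abs_midTerm_le {σ : ℝ} (hσ : 1 ≤ σ) {f : ℝ → ℝ} (hper : Function.Periodic f 1) {n : ℕ}
    (hn : 2 ≤ n) : |midTerm σ f n| ≤ 4 * f (1 / 2) ^ 2 * φ⁻¹ ^ n := by
  obtain ⟨l, rfl⟩ : ∃ l, n = l + 2 := ⟨n - 2, by omega⟩
  have hF1 : (1 : ℝ) ≤ Nat.fib (l + 2) := by
    exact_mod_cast Nat.fib_pos.2 (by omega)
  have hpos : 0 ≤ 4 * f (1 / 2) ^ 2 * φ⁻¹ ^ (l + 2) := by
    have := (inv_goldenRatio_pow_bounds (l + 2)).1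
    positivity
  have hhalf : sinWeight σ f (1 / 2) = f (1 / 2) := by
    rw [sinWeight, mul_one_div, sin_pi_div_two]; simp
  rw [midTerm]
  by_cases heven : ∃ m, 2 * m = Nat.fib (l + 2)
  · obtain ⟨m, hm⟩ := heven
    have hset : (Finset.Ico 1 (Nat.fib (l + 2))).filter (fun x => 2 * x = Nat.fib (l + 2))
        = {m} := by
      ext x
      have := Nat.fib_pos.2 (show 0 < l + 2 by omega)
      simp only [Finset.mem_filter, Finset.mem_Ico, Finset.mem_singleton]
      omega
    -- `F_{n-1}` is odd, so the second argument is `1 / 2` modulo `1` as well.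
    have hodd : Odd (Nat.fib (l + 1)) := by
      rw [← Nat.not_even_iff_odd]
      intro he
      have hc := Nat.fib_coprime_fib_succ (l + 1)
      have h2 := Nat.dvd_gcd he.two_dvd (Dvd.intro _ hm)
      rw [hc] at h2
      omega
    obtain ⟨q, hq⟩ := hodd
    have hmr : (Nat.fib (l + 2) : ℝ) = 2 * m := by exact_mod_cast hm.symm
    have hm0 : (m : ℝ) ≠ 0 := by
      intro h; rw [h] at hmr; linarith
    have e1 : ((m : ℤ) : ℝ) / Nat.fib (l + 2) = 1 / 2 := by
      rw [hmr, Int.cast_natCast]; field_simp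
    have e2 : (Nat.fib (l + 2 - 1) : ℝ) * ((m : ℤ) : ℝ) / Nat.fib (l + 2)
        = 1 / 2 + ((q : ℤ) : ℝ) := by
      rw [show l + 2 - 1 = l + 1 by omega, hq, hmr, Int.cast_natCast]
      push_cast
      field_simp
      ring
    rw [hset, Finset.sum_singleton, fibTerm, e1, e2, sinWeight_add_int σ hper, hhalf, ← pow_two,
      abs_of_nonneg (by positivity), one_div, ← rpow_neg (by linarith)]
    have h1 : (Nat.fib (l + 2) : ℝ) ^ (-σ) ≤ φ⁻¹ ^ l := by
      rw [rpow_neg (by linarith), inv_pow]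
      refine inv_anti₀ (pow_pos goldenRatio_pos _) ((goldenRatio_pow_le_fib l).trans ?_)
      exact self_le_rpow_of_one_le hF1 hσ
    have h2 : φ⁻¹ ^ l ≤ 4 * φ⁻¹ ^ (l + 2) := by
      have h3 := (inv_goldenRatio_pow_bounds l).1
      have h4 : 1 / 4 ≤ φ⁻¹ ^ 2 := by
        rw [inv_goldenRatio_eq]; nlinarith [goldenRatio_gt]
      rw [pow_add]
      nlinarith
    have h5 := mul_le_mul_of_nonneg_right (h1.trans h2) (sq_nonneg (f (1 / 2)))
    linarith
  · have hset : (Finset.Ico 1 (Nat.fib (l + 2))).filter (fun x => 2 * x = Nat.fib (l + 2))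
        = ∅ := by
      ext x
      simp only [Finset.mem_filter, Finset.notMem_empty, iff_false, not_and]
      exact fun _ h => heven ⟨x, h⟩
    rwa [hset, Finset.sum_empty, abs_zero]

/-! ### The contribution of a row -/

theorem geometric_tail {d : ℕ → ℝ} {c ρ : ℝ} (hρ0 : 0 < ρ) (hρ1 : ρ < 1)
    (hd : ∀ k, |d k| ≤ c * ρ ^ (k + 1)) (N : ℕ) :
    Summable d ∧ |∑ k ∈ Finset.range N, d k - ∑' k, d k| ≤ c / (1 - ρ) * ρ ^ (N + 1) := by
  have hgeo : ∀ M : ℕ, HasSum (fun k => c * ρ ^ (k + M + 1)) (c / (1 - ρ) * ρ ^ (M + 1)) := by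
    intro M
    have h := (hasSum_geometric_of_lt_one hρ0.le hρ1).mul_left (c * ρ ^ (M + 1))
    have e1 : (fun k => c * ρ ^ (k + M + 1)) = fun k => c * ρ ^ (M + 1) * ρ ^ k := by
      funext k; ring
    have e2 : c / (1 - ρ) * ρ ^ (M + 1) = c * ρ ^ (M + 1) * (1 - ρ)⁻¹ := by
      rw [div_eq_mul_inv]; ring
    rw [e1, e2]
    exact h
  have hsum : Summable d := Summable.of_norm_bounded (hgeo 0).summable (fun k => hd k)
  refine ⟨hsum, ?_⟩
  rw [← hsum.sum_add_tsum_nat_add N, sub_add_cancel_left, abs_neg]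
  exact tsum_of_norm_bounded (f := fun k => d (k + N)) (hgeo N) (fun k => hd (k + N))

/-- If `T k` is `R` plus a term of a summable sequence `d`, a term of a summable sequence `d'` read
backwards and an error, all geometrically small, then the sum of the `T k` is affine in the number
of terms up to a geometrically small error. -/
theorem abs_sum_range_sub_tsum_le {d d' T : ℕ → ℝ} {R c ρ : ℝ} (hρ0 : 0 < ρ) (hρ1 : ρ < 1)
    (hd : ∀ k, |d k| ≤ c * ρ ^ (k + 1)) (hd' : ∀ k, |d' k| ≤ c * ρ ^ (k + 1)) (N : ℕ)
    (hT : ∀ k j, k + j + 1 = N → |T k - R - d k - d' j| ≤ c * ρ ^ (N + 1)) :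
    |∑ k ∈ Finset.range N, T k - (N * R + ∑' k, d k + ∑' k, d' k)|
      ≤ c * (N + 2 / (1 - ρ)) * ρ ^ (N + 1) := by
  have h1 := (geometric_tail hρ0 hρ1 hd N).2
  have h2 := (geometric_tail hρ0 hρ1 hd' N).2
  have h3 : |∑ k ∈ Finset.range N, (T k - R - d k - d' (N - 1 - k))| ≤ N * (c * ρ ^ (N + 1)) := by
    refine (Finset.abs_sum_le_sum_abs _ _).trans ?_
    refine (Finset.sum_le_card_nsmul _ _ (c * ρ ^ (N + 1)) fun k hk => ?_).trans ?_
    · rw [Finset.mem_range] at hk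
      exact hT _ _ (by omega)
    · rw [Finset.card_range, nsmul_eq_mul]
  simp only [Finset.sum_sub_distrib] at h3
  rw [Finset.sum_range_reflect d' N, Finset.sum_const, Finset.card_range, nsmul_eq_mul] at h3
  have e : c * (N + 2 / (1 - ρ)) * ρ ^ (N + 1)
      = N * (c * ρ ^ (N + 1)) + 2 * (c / (1 - ρ) * ρ ^ (N + 1)) := by ring
  rw [e]
  rw [abs_le] at *
  constructor <;> linarith

theorem constDTerm_eq (σ : ℝ) (f : ℝ → ℝ) {i : ℕ} (hi : 1 ≤ i) :
    constDTerm σ f i = delta σ f i + deltaDual σ f i - ((mu i : ℝ) + 1) * rowLimit σ f i := by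
  rw [constDTerm, rowLimit_eq σ f hi, rowScale_eq σ hi]
  ring

/-- The difference between the contribution of row `i` to half of the Fibonacci sum and its
contribution to `(C n + D) / 2`. -/
noncomputable def rowDefect (σ : ℝ) (f : ℝ → ℝ) (n i : ℕ) : ℝ :=
  ∑ k ∈ Finset.range (n - mu i - 1), fibTerm σ f n (wythoff i (k + 1))
    - (n * rowLimit σ f i + constDTerm σ f i)

/-- The truncated exponent `n - μ_i` makes this a bound for the rows that reach below `F_n / 2` and
for the remaining ones at the same time. -/
theorem exists_abs_rowDefect_le (σ : ℝ) {α : ℝ} (hα0 : 0 < α) (hα1 : α ≤ 1) {f : ℝ → ℝ}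
    (hper : Function.Periodic f 1) (hsymm : ∀ t : ℝ, f t = f (1 - t))
    {L : ℝ} (hL : 0 ≤ L)
    (hf : ∀ x ∈ Set.Ico (0 : ℝ) 1, ∀ y ∈ Set.Ico (0 : ℝ) 1, |f x - f y| ≤ L * |x - y| ^ α) :
    (∀ i : ℕ, 1 ≤ i → Summable (fun k : ℕ => deltaTerm σ f i (k + 1))) ∧
    (∀ i : ℕ, 1 ≤ i → Summable (fun j : ℕ => deltaDualTerm σ f i (j + 1))) ∧
    ∃ K : ℝ, 0 ≤ K ∧ ∀ n i : ℕ, 1 ≤ i →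
      |rowDefect σ f n i| ≤ K * rowScale σ i * ((mu i + 1) * (n + 1)) * (φ⁻¹ ^ α) ^ (n - mu i) := by
  obtain ⟨C, hC, hbd⟩ := exists_row_bounds σ hα0 hα1 hper hsymm hL hf
  obtain ⟨t0, t1⟩ := inv_goldenRatio_bounds
  have hρ0 : 0 < φ⁻¹ ^ α := rpow_pos_of_pos t0 _
  have hρ1 : φ⁻¹ ^ α < 1 := rpow_lt_one t0.le (by linarith) hα0
  set ρ := φ⁻¹ ^ α with hρ
  have hρ2 : 0 < 1 - ρ := by linarith
  refine ⟨fun i hi => (geometric_tail hρ0 hρ1 (hbd i hi).1 0).1,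
    fun i hi => (geometric_tail hρ0 hρ1 (hbd i hi).2.1 0).1,
    (C + 2 * C / (1 - ρ) + f 0 ^ 2) / ρ, by positivity, fun n i hi => ?_⟩
  obtain ⟨hd, hd', hT⟩ := hbd i hi
  have hs := rowScale_pos σ hi
  have hμ : (0 : ℝ) ≤ mu i := Nat.cast_nonneg _
  have hn : (0 : ℝ) ≤ n := Nat.cast_nonneg _
  have hCρ : 0 ≤ 2 * C / (1 - ρ) := by positivity
  rw [rowDefect, constDTerm_eq σ f hi]
  rcases le_or_gt (mu i + 2) n with h | h
  · obtain ⟨N, rfl⟩ : ∃ N, n = mu i + (N + 1) := ⟨n - mu i - 1, by omega⟩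
    have key := abs_sum_range_sub_tsum_le (R := rowLimit σ f i)
      (T := fun k => fibTerm σ f (mu i + (N + 1)) (wythoff i (k + 1))) hρ0 hρ1 hd hd' N (by
        intro k j hkj
        have h1 := hT k j
        rw [show k + 1 + (mu i + (j + 1)) = mu i + (N + 1) by omega,
          show k + 1 + (j + 1) = N + 1 by omega] at h1
        exact h1)
    rw [show mu i + (N + 1) - mu i - 1 = N by omega, show mu i + (N + 1) - mu i = N + 1 by omega]
    have e : ((mu i + (N + 1) : ℕ) : ℝ) * rowLimit σ f i + (delta σ f i + deltaDual σ f i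
        - ((mu i : ℝ) + 1) * rowLimit σ f i)
        = N * rowLimit σ f i + ∑' k, deltaTerm σ f i (k + 1)
          + ∑' k, deltaDualTerm σ f i (k + 1) := by
      rw [delta, deltaDual]; push_cast; ring
    rw [e]
    refine key.trans (mul_le_mul_of_nonneg_right ?_ (pow_pos hρ0 _).le)
    push_cast
    have hN : (0 : ℝ) ≤ N := Nat.cast_nonneg _
    have hc1 : C * (N + 2 / (1 - ρ))
        ≤ (C + 2 * C / (1 - ρ) + f 0 ^ 2) * (((mu i : ℝ) + 1) * (mu i + (N + 1) + 1)) := by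
      have e2 : C * (N + 2 / (1 - ρ)) = C * N + 2 * C / (1 - ρ) := by ring
      have h2 : (N : ℝ) + 1 ≤ ((mu i : ℝ) + 1) * (mu i + (N + 1) + 1) := by nlinarith
      have h3 : (C + 2 * C / (1 - ρ) + f 0 ^ 2) * ((N : ℝ) + 1)
          ≤ (C + 2 * C / (1 - ρ) + f 0 ^ 2) * (((mu i : ℝ) + 1) * (mu i + (N + 1) + 1)) :=
        mul_le_mul_of_nonneg_left h2 (by positivity)
      have h4 : 0 ≤ (2 * C / (1 - ρ)) * N := by positivity
      have h5 : 0 ≤ f 0 ^ 2 * ((N : ℝ) + 1) := by positivity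
      linarith
    have h6 : C + 2 * C / (1 - ρ) + f 0 ^ 2 ≤ (C + 2 * C / (1 - ρ) + f 0 ^ 2) / ρ :=
      le_div_self (by positivity) hρ0 hρ1.le
    have h7 := mul_le_mul_of_nonneg_right h6
      (show 0 ≤ ((mu i : ℝ) + 1) * (mu i + (N + 1) + 1) by positivity)
    have h8 := mul_le_mul_of_nonneg_left (hc1.trans h7) hs.le
    linarith
  · have e0 : n - mu i - 1 = 0 := by omega
    rw [e0, Finset.range_zero, Finset.sum_empty, zero_sub, abs_neg]
    have a1 := (geometric_tail hρ0 hρ1 hd 0).2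
    have a2 := (geometric_tail hρ0 hρ1 hd' 0).2
    rw [Finset.range_zero, Finset.sum_empty, zero_sub, abs_neg, zero_add, pow_one] at a1 a2
    have hle : ρ ≤ ρ ^ (n - mu i) := by
      have := pow_le_pow_of_le_one hρ0.le hρ1.le (show n - mu i ≤ 1 by omega)
      rwa [pow_one] at this
    have hnμ : (n : ℝ) ≤ mu i + 1 := by exact_mod_cast Nat.lt_succ_iff.1 h
    have a3 : |((n : ℝ) - (mu i + 1)) * rowLimit σ f i|
        ≤ (mu i + 1) * (rowScale σ i * f 0 ^ 2) := by
      rw [abs_mul, rowLimit_eq σ f hi, abs_of_nonneg (by positivity : 0 ≤ rowScale σ i * f 0 ^ 2)]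
      refine mul_le_mul_of_nonneg_right ?_ (by positivity)
      rw [abs_le]
      constructor <;> linarith
    have e : (n : ℝ) * rowLimit σ f i + (delta σ f i + deltaDual σ f i
        - ((mu i : ℝ) + 1) * rowLimit σ f i)
        = ((n : ℝ) - (mu i + 1)) * rowLimit σ f i + delta σ f i + deltaDual σ f i := by ring
    rw [e]
    refine (abs_add_three _ _ _).trans ?_
    rw [delta, deltaDual]
    set Q := C + 2 * C / (1 - ρ) + f 0 ^ 2 with hQ
    have hQ0 : 0 ≤ Q := by positivity
    have a4 : C * rowScale σ i / (1 - ρ) * ρ ≤ C * rowScale σ i / (1 - ρ) :=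
      mul_le_of_le_one_right (by positivity) hρ1.le
    have b1 : Q * rowScale σ i * (mu i + 1)
        ≤ Q / ρ * rowScale σ i * ((mu i + 1) * (n + 1)) * ρ ^ (n - mu i) := by
      have b2 : Q / ρ * rowScale σ i * ((mu i + 1) * (n + 1)) * ρ
          ≤ Q / ρ * rowScale σ i * ((mu i + 1) * (n + 1)) * ρ ^ (n - mu i) :=
        mul_le_mul_of_nonneg_left hle (by positivity)
      have b3 : Q / ρ * rowScale σ i * ((mu i + 1) * (n + 1)) * ρ
          = Q * rowScale σ i * (mu i + 1) * (n + 1) := by field_simp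
      have b4 : 0 ≤ Q * rowScale σ i * (mu i + 1) * n := by positivity
      linarith
    refine le_trans ?_ b1
    have b5 : Q * rowScale σ i * (mu i + 1) = C * rowScale σ i * (mu i + 1)
        + 2 * (C * rowScale σ i / (1 - ρ)) * (mu i + 1)
        + (mu i + 1) * (rowScale σ i * f 0 ^ 2) := by rw [hQ]; ring
    have b6 : 0 ≤ C * rowScale σ i * (mu i + 1) := by positivity
    have b7 : 0 ≤ (C * rowScale σ i / (1 - ρ)) * mu i := by positivity
    linarith

/-! ### The sum over the rows -/

theorem one_div_eta_rpow_le {σ : ℝ} (hσ : 0 ≤ σ) {i : ℕ} (hi : 1 ≤ i) :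
    1 / eta i ^ σ ≤ 10 ^ σ * φ ^ (-(σ * mu i)) := by
  have h := goldenRatio_pow_mu_le hi
  have hη := eta_pos hi
  have hp := pow_pos goldenRatio_pos (mu i)
  have h1 := rpow_le_rpow hp.le h hσ
  rw [mul_rpow (by norm_num) hη.le, ← rpow_natCast, ← rpow_mul goldenRatio_pos.le,
    mul_comm (mu i : ℝ) σ] at h1
  rw [rpow_neg goldenRatio_pos.le, div_le_iff₀ (rpow_pos_of_pos hη _)]
  have h2 := rpow_pos_of_pos goldenRatio_pos (σ * mu i)
  calc (1 : ℝ) = φ ^ (σ * mu i) * (φ ^ (σ * mu i))⁻¹ := (mul_inv_cancel₀ h2.ne').symm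
    _ ≤ 10 ^ σ * eta i ^ σ * (φ ^ (σ * mu i))⁻¹ :=
      mul_le_mul_of_nonneg_right h1 (inv_nonneg.2 h2.le)
    _ = _ := by ring

/-- Row `i` has `φ ^ μ_i ≥ i`, so exponents below `-1` are summable over the rows; the factor
`μ_i + 1` is absorbed into a small power. -/
theorem summable_mu_mul_rpow {s : ℝ} (hs : 1 < s) :
    Summable (fun i : ℕ => ((mu (i + 1) : ℝ) + 1) * φ ^ (-(s * mu (i + 1)))) := by
  have hφ := goldenRatio_pos
  obtain ⟨r, hr1, hrs⟩ := exists_between hs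
  have hg : 1 < φ ^ (s - r) := one_lt_rpow one_lt_goldenRatio (by linarith)
  obtain ⟨h, hh⟩ : ∃ h, φ ^ (s - r) = 1 + h := ⟨φ ^ (s - r) - 1, by ring⟩
  have hh0 : 0 < h := by linarith
  have hsum : Summable (fun i : ℕ => (1 + 1 / h) * ((i + 1 : ℕ) : ℝ) ^ (-r)) :=
    (((summable_nat_add_iff 1).2 (summable_nat_rpow.2 (by linarith : -r < -1)))).mul_left _
  refine Summable.of_nonneg_of_le (fun i => by positivity) (fun i => ?_) hsum
  have hidx := index_le_goldenRatio_pow_mu (i := i + 1) (by omega)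
  generalize mu (i + 1) = m at *
  have h1 : (m : ℝ) + 1 ≤ (1 + 1 / h) * φ ^ ((s - r) * m) := by
    have h2 := one_add_mul_le_pow (show -2 ≤ h by linarith) m
    rw [← hh, ← rpow_natCast, ← rpow_mul hφ.le] at h2
    have h3 := mul_le_mul_of_nonneg_left h2 (show 0 ≤ 1 + 1 / h by positivity)
    have h4 : (1 + 1 / h) * (1 + m * h) = m + 1 + m * h + 1 / h := by field_simp; ring
    have h5 : 0 ≤ m * h + 1 / h := by positivity
    linarith
  have h6 : φ ^ (-(r * m)) ≤ ((i + 1 : ℕ) : ℝ) ^ (-r) := by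
    have h7 : φ ^ (-(r * m)) = (φ ^ m) ^ (-r) := by
      rw [← rpow_natCast, ← rpow_mul hφ.le]; congr 1; ring
    rw [h7]
    exact rpow_le_rpow_of_nonpos (by positivity) hidx (by linarith)
  calc ((m : ℝ) + 1) * φ ^ (-(s * m))
      ≤ (1 + 1 / h) * φ ^ ((s - r) * m) * φ ^ (-(s * m)) :=
        mul_le_mul_of_nonneg_right h1 (rpow_nonneg hφ.le _)
    _ = (1 + 1 / h) * φ ^ (-(r * m)) := by
        rw [mul_assoc, ← rpow_add hφ]; congr 2; ring
    _ ≤ _ := mul_le_mul_of_nonneg_left h6 (by positivity)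

theorem inv_rpow_pow_tsub_le {α δ : ℝ} (hδ : 0 ≤ δ) (hδα : δ ≤ α) (n m : ℕ) :
    (φ⁻¹ ^ α) ^ (n - m) ≤ φ ^ (δ * m) * φ ^ (-(δ * n)) := by
  have hφ := goldenRatio_pos
  rw [← rpow_add hφ, inv_rpow hφ.le, ← rpow_neg hφ.le, ← rpow_natCast, ← rpow_mul hφ.le]
  refine rpow_le_rpow_of_exponent_le one_lt_goldenRatio.le ?_
  have h1 : (n : ℝ) - m ≤ ((n - m : ℕ) : ℝ) := by
    rw [sub_le_iff_le_add]; exact_mod_cast le_tsub_add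
  have h2 : (0 : ℝ) ≤ ((n - m : ℕ) : ℝ) := Nat.cast_nonneg _
  nlinarith

/-- The defects of all rows together. Half of the exponent `min α (σ - 1)` is spent on the
convergence of the sum over the rows. -/
theorem exists_abs_rowDefect_le_summable {σ : ℝ} (hσ : 1 < σ) {α : ℝ} (hα0 : 0 < α) (hα1 : α ≤ 1)
    {f : ℝ → ℝ} (hper : Function.Periodic f 1) (hsymm : ∀ t : ℝ, f t = f (1 - t))
    {L : ℝ} (hL : 0 ≤ L)
    (hf : ∀ x ∈ Set.Ico (0 : ℝ) 1, ∀ y ∈ Set.Ico (0 : ℝ) 1, |f x - f y| ≤ L * |x - y| ^ α) :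
    ∃ S : ℕ → ℝ, Summable S ∧ ∀ n i : ℕ, |rowDefect σ f n (i + 1)|
      ≤ S i * ((n + 1) * φ ^ (-(min α (σ - 1) / 2 * n))) := by
  obtain ⟨-, -, K, hK, hbd⟩ := exists_abs_rowDefect_le σ hα0 hα1 hper hsymm hL hf
  have hφ := goldenRatio_pos
  obtain ⟨δ, hδ⟩ : ∃ δ, δ = min α (σ - 1) / 2 := ⟨_, rfl⟩
  have hm1 : min α (σ - 1) ≤ α := min_le_left _ _
  have hm2 : min α (σ - 1) ≤ σ - 1 := min_le_right _ _
  have hm0 : 0 < min α (σ - 1) := lt_min hα0 (by linarith)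
  rw [← hδ]
  obtain ⟨c, hc⟩ : ∃ c, c = (5 : ℝ) ^ (σ / 2) / π ^ (2 * σ) := ⟨_, rfl⟩
  have hc0 : 0 ≤ c := by rw [hc]; have := pi_pos; positivity
  refine ⟨fun i => K * (c * 10 ^ σ) * (((mu (i + 1) : ℝ) + 1) * φ ^ (-((σ - δ) * mu (i + 1)))),
    (summable_mu_mul_rpow (by linarith)).mul_left _, fun n i => ?_⟩
  have hi : 1 ≤ i + 1 := by omega
  refine (hbd n (i + 1) hi).trans ?_
  have h1 := inv_rpow_pow_tsub_le (α := α) (δ := δ) (by linarith) (by linarith) n (mu (i + 1))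
  have h2 : rowScale σ (i + 1) ≤ c * (10 ^ σ * φ ^ (-(σ * mu (i + 1)))) := by
    rw [rowScale_eq σ hi, ← hc]
    exact mul_le_mul_of_nonneg_left (one_div_eta_rpow_le (by linarith) hi) hc0
  beta_reduce
  generalize mu (i + 1) = m at *
  have h3 : φ ^ (-((σ - δ) * m)) = φ ^ (-(σ * m)) * φ ^ (δ * m) := by
    rw [← rpow_add hφ]; congr 1; ring
  have h4 := rowScale_pos σ hi
  calc K * rowScale σ (i + 1) * (((m : ℝ) + 1) * (n + 1)) * (φ⁻¹ ^ α) ^ (n - m)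
      ≤ K * (c * (10 ^ σ * φ ^ (-(σ * m)))) * (((m : ℝ) + 1) * (n + 1))
        * (φ ^ (δ * m) * φ ^ (-(δ * n))) := by gcongr
    _ = _ := by rw [h3]; ring

theorem summable_one_div_eta_rpow {σ : ℝ} (hσ : 1 < σ) :
    Summable (fun i : ℕ => 1 / eta (i + 1) ^ σ) := by
  refine Summable.of_nonneg_of_le (fun i => ?_) (fun i => ?_)
    ((summable_mu_mul_rpow hσ).mul_left (10 ^ σ))
  · have := eta_pos (i := i + 1) (by omega)
    positivity
  · refine (one_div_eta_rpow_le (by linarith) (by omega)).trans ?_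
    have h1 := rpow_pos_of_pos goldenRatio_pos (-(σ * mu (i + 1)))
    have h2 : (0 : ℝ) ≤ mu (i + 1) := Nat.cast_nonneg _
    refine mul_le_mul_of_nonneg_left ?_ (by positivity)
    nlinarith

theorem constC_eq (σ : ℝ) (f : ℝ → ℝ) : constC σ f = 2 * ∑' i : ℕ, rowLimit σ f (i + 1) := by
  have h : ∀ i : ℕ, rowLimit σ f (i + 1)
      = f 0 ^ 2 * (5 : ℝ) ^ (σ / 2) / π ^ (2 * σ) * (1 / eta (i + 1) ^ σ) := by
    intro i
    rw [rowLimit_eq σ f (by omega), rowScale_eq σ (by omega)]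
    ring
  rw [constC, tsum_congr h, tsum_mul_left, mul_assoc]

end FibLattice

theorem theorem1 (σ : ℝ) (hσ : 1 < σ) (α : ℝ) (hα0 : 0 < α) (hα1 : α ≤ 1) (f : ℝ → ℝ)
    (hper : Function.Periodic f 1) (hsymm : ∀ t : ℝ, f t = f (1 - t))
    (hHolder : ∃ L : ℝ, 0 ≤ L ∧ ∀ x ∈ Set.Ico (0 : ℝ) 1, ∀ y ∈ Set.Ico (0 : ℝ) 1,
      |f x - f y| ≤ L * |x - y| ^ α) :
    Summable (fun i : ℕ => 1 / FibLattice.eta (i + 1) ^ σ) ∧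
    (∀ i : ℕ, 1 ≤ i → Summable (fun k : ℕ => FibLattice.deltaTerm σ f i (k + 1))) ∧
    (∀ i : ℕ, 1 ≤ i → Summable (fun j : ℕ => FibLattice.deltaDualTerm σ f i (j + 1))) ∧
    Summable (fun i : ℕ => FibLattice.constDTerm σ f (i + 1)) ∧
    Asymptotics.IsBigO Filter.atTop
      (fun n : ℕ => FibLattice.fibSum σ f n
        - (FibLattice.constC σ f * (n : ℝ) + FibLattice.constD σ f))
      (fun n : ℕ => (n : ℝ) ^ 2 / Real.goldenRatio ^ (min α (σ - 1) * (n : ℝ) / 2)) := by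
  obtain ⟨L, hL, hf⟩ := hHolder
  obtain ⟨hδ, hδ', -⟩ := FibLattice.exists_abs_rowDefect_le σ hα0 hα1 hper hsymm hL hf
  obtain ⟨S, hS, hbd⟩ :=
    FibLattice.exists_abs_rowDefect_le_summable hσ hα0 hα1 hper hsymm hL hf
  have hη := FibLattice.summable_one_div_eta_rpow hσ
  have hR : Summable (fun i : ℕ => FibLattice.rowLimit σ f (i + 1)) := by
    refine (hη.mul_left (f 0 ^ 2 * (5 : ℝ) ^ (σ / 2) / Real.pi ^ (2 * σ))).congr fun i => ?_
    rw [FibLattice.rowLimit_eq σ f (by omega), FibLattice.rowScale_eq σ (by omega)]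
    ring
  have hdef : ∀ n : ℕ, Summable (fun i : ℕ => FibLattice.rowDefect σ f n (i + 1)) := fun n =>
    Summable.of_norm_bounded (hS.mul_right _) (hbd n)
  -- For `n = 0` the defect of a row is the negative of its contribution to `D / 2`.
  have hD : Summable (fun i : ℕ => FibLattice.constDTerm σ f (i + 1)) := by
    refine (hdef 0).neg.congr fun i => ?_
    simp [FibLattice.rowDefect]
  refine ⟨hη, hδ, hδ', hD, ?_⟩
  refine Asymptotics.IsBigO.of_bound (4 * ∑' i, S i + 4 * f (1 / 2) ^ 2) ?_
  filter_upwards [Filter.eventually_ge_atTop 2] with n hn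
  have hmid := FibLattice.abs_midTerm_le hσ.le hper (σ := σ) hn
  have e : FibLattice.fibSum σ f n - (FibLattice.constC σ f * (n : ℝ) + FibLattice.constD σ f)
      = 2 * ∑' i : ℕ, FibLattice.rowDefect σ f n (i + 1) + FibLattice.midTerm σ f n := by
    have h1 : ∀ i : ℕ, ∑ k ∈ Finset.range (n - FibLattice.mu (i + 1) - 1),
        FibLattice.fibTerm σ f n (FibLattice.wythoff (i + 1) (k + 1))
        = FibLattice.rowDefect σ f n (i + 1) + (n * FibLattice.rowLimit σ f (i + 1)
          + FibLattice.constDTerm σ f (i + 1)) := fun i => by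
      rw [FibLattice.rowDefect, sub_add_cancel]
    rw [FibLattice.fibSum_eq_sum_rows σ hper hsymm (by omega), tsum_congr h1,
      (hdef n).tsum_add ((hR.mul_left _).add hD), (hR.mul_left _).tsum_add hD, tsum_mul_left,
      FibLattice.constC_eq, FibLattice.constD]
    ring
  have hφ := Real.goldenRatio_pos
  have hn1 : (2 : ℝ) ≤ n := by exact_mod_cast hn
  obtain ⟨Z, hZ⟩ : ∃ Z, Z = Real.goldenRatio ^ (-(min α (σ - 1) / 2 * n)) := ⟨_, rfl⟩
  have hZ0 : 0 < Z := by rw [hZ]; exact Real.rpow_pos_of_pos hφ _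
  have htarget : (n : ℝ) ^ 2 / Real.goldenRatio ^ (min α (σ - 1) * (n : ℝ) / 2)
      = (n : ℝ) ^ 2 * Z := by
    rw [hZ, Real.rpow_neg hφ.le, div_eq_mul_inv]
    congr 3; ring
  have hpow : Real.goldenRatio⁻¹ ^ n ≤ Z := by
    rw [hZ, inv_pow, ← Real.rpow_natCast, ← Real.rpow_neg hφ.le]
    refine Real.rpow_le_rpow_of_exponent_le Real.one_lt_goldenRatio.le ?_
    have : min α (σ - 1) ≤ α := min_le_left _ _
    nlinarith
  have htsum : |∑' i : ℕ, FibLattice.rowDefect σ f n (i + 1)| ≤ (∑' i, S i) * ((n + 1) * Z) := by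
    rw [hZ]
    exact tsum_of_norm_bounded (f := fun i => FibLattice.rowDefect σ f n (i + 1))
      (hS.hasSum.mul_right _) (hbd n)
  have hS0 : 0 ≤ ∑' i, S i := by
    have h1 := (abs_nonneg _).trans htsum
    by_contra h
    nlinarith [mul_pos (by linarith : (0 : ℝ) < n + 1) hZ0]
  rw [e, htarget, Real.norm_eq_abs, Real.norm_eq_abs,
    abs_of_nonneg (show 0 ≤ (n : ℝ) ^ 2 * Z by positivity)]
  refine (abs_add_le _ _).trans ?_
  rw [abs_mul, abs_two]
  have b1 : (∑' i, S i) * ((n + 1) * Z) ≤ (∑' i, S i) * (2 * ((n : ℝ) ^ 2 * Z)) := by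
    refine mul_le_mul_of_nonneg_left ?_ hS0
    rw [← mul_assoc]
    exact mul_le_mul_of_nonneg_right (by nlinarith) hZ0.le
  have b2 : Real.goldenRatio⁻¹ ^ n ≤ (n : ℝ) ^ 2 * Z := hpow.trans
    (le_mul_of_one_le_left hZ0.le (by nlinarith))
  have b3 := mul_le_mul_of_nonneg_left b2 (show 0 ≤ 4 * f (1 / 2) ^ 2 by positivity)
  linarith
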